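/- All graphs are finite and simple. Let $P_k$ be the path with $k$ edges, let $\widehat H$ denote the suspension of a graph $H$ (the graph obtained from $H$ by adding one new vertex adjacent to all vertices of $H$), and let $\mathrm{ex}(n,K_3,F)$ be the maximum number of triangles in an $n$-vertex graph that contains no (not necessarily induced) subgraph isomorphic to $F$. Then, as $n\to\infty$: (i) for each $k\in\{3,4,5\}$, $\displaystyle \mathrm{ex}(n,K_3,\widehat{P}_k)=\left\lfloor\frac{k-1}{2}\right\rfloor\cdot\frac{n^2}{8}+o(n^2)$; (ii) for $k=3$ and $k=5$ the error term can be improved to $O(n)$, i.e. $\displaystyle \mathrm{ex}(n,K_3,\widehat{P}_k)=\left\lfloor\frac{k-1}{2}\right\rfloor\cdot\frac{n^2}{8}+O(n)$. Moreover, the following explicit upper bounds hold for every $n\ge 1$: every $\widehat{P}_3$-free graph on $n$ vertices has fewer than $\frac{n^2}{8}+3n$ triangles, and every $\widehat{P}_5$-free graph on $n$ vertices has at most $\frac{n^2}{4}+5n$ triangles. -/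

import Mathlib

open Asymptotics Filter

/-- The suspension of a graph `H`: a new vertex (`none`) is added and joined to every vertex
of `H`. -/
def suspension {W : Type*} (H : SimpleGraph W) : SimpleGraph (Option W) where
  Adj
    | none, none => False
    | none, some _ => True
    | some _, none => True
    | some u, some v => H.Adj u v
  symm := ⟨by
    rintro (_ | u) (_ | v) h
    · exact h
    · trivial
    · trivial
    · exact SimpleGraph.Adj.symm h⟩
  loopless := ⟨by
    rintro (_ | u) h
    · exact h
    · exact H.irrefl h⟩

/-- The path with `k` edges (and `k + 1` vertices). -/
def pathWithEdges (k : ℕ) : SimpleGraph (Fin (k + 1)) := SimpleGraph.pathGraph (k + 1)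

open scoped Classical in
/-- The generalized Turán number `ex(n, T, H)`: the largest number of (unlabelled, not necessarily
induced) copies of `T` in an `H`-free graph on `n` vertices. -/
noncomputable def genTuran {U W : Type*} (n : ℕ) (T : SimpleGraph U) (H : SimpleGraph W) : ℕ :=
  (Finset.univ.filter fun G : SimpleGraph (Fin n) => H.Free G).sup fun G => G.copyCount T

/-- The complete graph on three vertices. -/
abbrev triangleGraph : SimpleGraph (Fin 3) := ⊤

/-! A graph is free of the suspended path with `k` edges exactly when no vertex has a path on `k +
1` vertices in its neighbourhood (`locallyPathFree_of_free`, `free_of_locallyPathFree`). Upper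
bounds come from charging triangles to edges. If every vertex set spanning an edge of `L` spans one
with at most `c` common `L`-neighbours inside the set, Mantel's deletion argument gives `L` at most
n²/4 + O(n) edges (`two_mul_adjPairs_le`).

For k = 3, in the absence of a K₄ every triangle has two edges lying in no other triangle, whence
n²/8 + O(n). A K₄ can be deleted together with few triangles, so induction finishes.

For k = 5, a K₄ is again deleted cheaply unless three outside vertices each see three of its
vertices, and then the K₄ has a vertex with three light edges (`exists_light_apex`). When every K₄
has such a vertex, triangles split into mild and heavy ones. Mild ones are charged to edges of
codegree at most two, heavy ones to edges of codegree at least three in at most two heavy triangles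
(`IsHeavyTriangle.heavyCodeg_le`). The union of these two edge sets still satisfies the deletion
criterion, so together they account for n²/4 + O(n) triangles.

For k = 4, triangles with two edges of codegree one are counted as for k = 3. Every edge lies in at
most four of the other triangles (`card_thick_le`), so there are O(n²) triangles in all; the
triangle removal lemma then hits them all with o(n²) edges, leaving o(n²) thick triangles.

Lower bounds: join an independent set on about half the vertices to a perfect matching (k = 3, 4) or
to disjoint triangles (k = 5) on the rest. -/

namespace SuspendedPath

/-! ### Ordered counts of edges and triangles, and locally path-free graphs -/

section

open Finset
open scoped Classical

variable {V : Type*}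

/-- The number of ordered pairs of adjacent vertices inside `A`. -/
noncomputable def adjPairs (G : SimpleGraph V) (A : Finset V) : ℕ :=
  ∑ x ∈ A, ∑ y ∈ A, if G.Adj x y then 1 else 0

/-- The number of ordered triangles inside `A`. -/
noncomputable def triTriples (G : SimpleGraph V) (A : Finset V) : ℕ :=
  ∑ x ∈ A, ∑ y ∈ A, ∑ z ∈ A, if G.Adj x y ∧ G.Adj x z ∧ G.Adj y z then 1 else 0

/-- The neighbours of `v` inside `A`. -/
noncomputable def nbrs (G : SimpleGraph V) (A : Finset V) (v : V) : Finset V :=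
  A.filter fun x => G.Adj v x

/-- No path on `k` vertices of `G` lies inside `s`. -/
def PathFreeOn (G : SimpleGraph V) (k : ℕ) (s : Set V) : Prop :=
  ∀ l : List V, l.Nodup → l.IsChain G.Adj → (∀ x ∈ l, x ∈ s) → l.length ≠ k

/-- No vertex has a path on `k` vertices in its neighbourhood. -/
def LocallyPathFree (G : SimpleGraph V) (k : ℕ) : Prop :=
  ∀ z, PathFreeOn G k {x | G.Adj z x}

variable {G : SimpleGraph V} {A B : Finset V}

@[simp] lemma mem_nbrs {v x : V} : x ∈ nbrs G A v ↔ x ∈ A ∧ G.Adj v x := by simp [nbrs]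

lemma PathFreeOn.mono {k : ℕ} {s t : Set V} (h : PathFreeOn G k t) (hst : s ⊆ t) :
    PathFreeOn G k s := fun l h1 h2 h3 => h l h1 h2 fun x hx => hst (h3 x hx)

lemma PathFreeOn.four {s : Set V} (h : PathFreeOn G 4 s) {a b c d : V}
    (ha : a ∈ s) (hb : b ∈ s) (hc : c ∈ s) (hd : d ∈ s)
    (hab : G.Adj a b) (hbc : G.Adj b c) (hcd : G.Adj c d) :
    a = c ∨ a = d ∨ b = d := by
  by_contra! hne
  refine h [a, b, c, d] ?_ ?_ ?_ rfl
  · simp [hab.ne, hbc.ne, hcd.ne, hne]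
  · simp [hab, hbc, hcd]
  · simp [ha, hb, hc, hd]

lemma PathFreeOn.five {s : Set V} (h : PathFreeOn G 5 s) {a b c d e : V}
    (ha : a ∈ s) (hb : b ∈ s) (hc : c ∈ s) (hd : d ∈ s) (he : e ∈ s)
    (hab : G.Adj a b) (hbc : G.Adj b c) (hcd : G.Adj c d) (hde : G.Adj d e) :
    a = c ∨ a = d ∨ a = e ∨ b = d ∨ b = e ∨ c = e := by
  by_contra! hne
  refine h [a, b, c, d, e] ?_ ?_ ?_ rfl
  · simp [hab.ne, hbc.ne, hcd.ne, hde.ne, hne]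
  · simp [hab, hbc, hcd, hde]
  · simp [ha, hb, hc, hd, he]

lemma PathFreeOn.six {s : Set V} (h : PathFreeOn G 6 s) {a b c d e f : V}
    (ha : a ∈ s) (hb : b ∈ s) (hc : c ∈ s) (hd : d ∈ s) (he : e ∈ s) (hf : f ∈ s)
    (hab : G.Adj a b) (hbc : G.Adj b c) (hcd : G.Adj c d) (hde : G.Adj d e) (hef : G.Adj e f) :
    a = c ∨ a = d ∨ a = e ∨ a = f ∨ b = d ∨ b = e ∨ b = f ∨ c = e ∨ c = f ∨ d = f := by
  by_contra! hne
  refine h [a, b, c, d, e, f] ?_ ?_ ?_ rfl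
  · simp [hab.ne, hbc.ne, hcd.ne, hde.ne, hef.ne, hne]
  · simp [hab, hbc, hcd, hde, hef]
  · simp [ha, hb, hc, hd, he, hf]

lemma card_nbrs_eq_sum (v : V) :
    (nbrs G A v).card = ∑ x ∈ A, if G.Adj v x then 1 else 0 := by
  rw [nbrs, Finset.card_filter]

lemma adjPairs_eq_sum_card : adjPairs G A = ∑ x ∈ A, (nbrs G A x).card := by
  simp [adjPairs, card_nbrs_eq_sum]

lemma adjPairs_eq_card :
    adjPairs G A = ((A ×ˢ A).filter fun p => G.Adj p.1 p.2).card := by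
  rw [Finset.card_filter, Finset.sum_product, adjPairs]

lemma adjPairs_insert {v : V} (hv : v ∉ A) :
    adjPairs G (insert v A) = adjPairs G A + 2 * (nbrs G A v).card := by
  have h : ∀ x, (if G.Adj x v then 1 else 0) = if G.Adj v x then 1 else 0 := fun x => by
    simp [G.adj_comm]
  simp only [adjPairs, Finset.sum_insert hv, Finset.sum_add_distrib, card_nbrs_eq_sum, h]
  simp
  ring

lemma nbrs_insert_of_adj {v w : V} (h : G.Adj v w) :
    nbrs G (insert w A) v = insert w (nbrs G A v) := by
  ext x; simp only [mem_nbrs, mem_insert]; grind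

lemma nbrs_insert_self {v : V} : nbrs G (insert v A) v = nbrs G A v := by
  ext x
  simp only [mem_nbrs, mem_insert]
  constructor
  · rintro ⟨rfl | h, h'⟩
    · exact absurd h' G.irrefl
    · exact ⟨h, h'⟩
  · exact fun h => ⟨.inr h.1, h.2⟩

lemma adjPairs_nbrs_eq (v : V) :
    adjPairs G (nbrs G A v) =
      ∑ y ∈ A, ∑ z ∈ A, if G.Adj v y ∧ G.Adj v z ∧ G.Adj y z then 1 else 0 := by
  simp only [adjPairs, nbrs, Finset.sum_filter]
  refine Finset.sum_congr rfl fun y _ => ?_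
  split_ifs with h
  · refine Finset.sum_congr rfl fun z _ => ?_
    by_cases h' : G.Adj v z <;> simp [h, h']
  · simp [h]

lemma triTriples_eq_sum : triTriples G A = ∑ v ∈ A, adjPairs G (nbrs G A v) := by
  simp only [adjPairs_nbrs_eq, triTriples]

lemma triTriples_insert {v : V} (hv : v ∉ A) :
    triTriples G (insert v A) = triTriples G A + 3 * adjPairs G (nbrs G A v) := by
  rw [triTriples_eq_sum, triTriples_eq_sum, Finset.sum_insert hv, nbrs_insert_self]
  have h : ∀ x ∈ A, adjPairs G (nbrs G (insert v A) x) =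
      adjPairs G (nbrs G A x) +
        if G.Adj x v then 2 * (nbrs G (nbrs G A x) v).card else 0 := by
    intro x _
    split_ifs with hx
    · rw [nbrs_insert_of_adj hx, adjPairs_insert (by simp [hv])]
    · rw [add_zero]
      congr 1
      ext y
      simp only [mem_nbrs, mem_insert]
      grind
  rw [Finset.sum_congr rfl h, Finset.sum_add_distrib]
  have h2 : ∑ x ∈ A, (if G.Adj x v then 2 * (nbrs G (nbrs G A x) v).card else 0) =
      2 * adjPairs G (nbrs G A v) := by
    rw [adjPairs_nbrs_eq, Finset.mul_sum]
    refine Finset.sum_congr rfl fun x _ => ?_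
    rw [Finset.mul_sum]
    by_cases hx : G.Adj x v
    · simp only [hx, if_true, hx.symm, true_and, nbrs, Finset.filter_filter, Finset.card_filter,
        Finset.mul_sum]
      refine Finset.sum_congr rfl fun y _ => ?_
      simp only [and_comm]
    · have : ¬ G.Adj v x := fun h => hx h.symm
      simp [hx, this]
  rw [h2]; ring

/-! ### Edge bounds: Mantel-type deletion and small Erdős–Gallai cases -/

/-- A graph in which every vertex set that spans an edge spans an edge of small codegree has few
edges. -/
lemma two_mul_adjPairs_le {L : SimpleGraph V} {c : ℕ} (U : Finset V)
    (h : ∀ W ⊆ U, (∃ x ∈ W, ∃ y ∈ W, L.Adj x y) →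
      ∃ x ∈ W, ∃ y ∈ W, L.Adj x y ∧ (nbrs L W x ∩ nbrs L W y).card ≤ c) :
    2 * adjPairs L U ≤ U.card ^ 2 + 2 * (c + 1) * U.card := by
  induction hn : U.card using Nat.strong_induction_on generalizing U with
  | _ n ih =>
  by_cases hU : ∃ x ∈ U, ∃ y ∈ U, L.Adj x y
  · obtain ⟨x, hx, y, hy, hxy, hc⟩ := h U subset_rfl hU
    obtain ⟨U', hU', rfl⟩ : ∃ U', y ∉ U' ∧ insert y U' = U :=
      ⟨U.erase y, by simp, Finset.insert_erase hy⟩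
    have hxU' : x ∈ U' := by
      rcases Finset.mem_insert.1 hx with rfl | h
      · exact absurd hxy L.irrefl
      · exact h
    obtain ⟨W, hxW, rfl⟩ : ∃ W, x ∉ W ∧ insert x W = U' :=
      ⟨U'.erase x, by simp, Finset.insert_erase hxU'⟩
    have hcard : (insert y (insert x W)).card = W.card + 2 := by
      rw [Finset.card_insert_of_notMem hU', Finset.card_insert_of_notMem hxW]
    have hrec := ih W.card (by omega) W
      (fun W' hW' => h W' (hW'.trans ((Finset.subset_insert _ _).trans
        (Finset.subset_insert _ _)))) rfl
    -- Mantel's step: deleting both ends of an edge with few common neighbours removes at most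
    -- `W.card + c + 1` edges, the last being `xy` itself.
    have hsum : (nbrs L W x).card + (nbrs L W y).card ≤ W.card + c := by
      rw [← Finset.card_union_add_card_inter]
      refine add_le_add (Finset.card_le_card fun z => ?_)
        ((Finset.card_le_card fun z => ?_).trans hc)
      · simp only [mem_union, mem_nbrs]; tauto
      · simp only [mem_inter, mem_nbrs, mem_insert]; tauto
    rw [adjPairs_insert hU', adjPairs_insert hxW, nbrs_insert_of_adj hxy.symm,
      Finset.card_insert_of_notMem (by simp [hxW])]
    rw [hcard] at hn
    subst hn
    nlinarith
  · have : adjPairs L U = 0 := by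
      rw [adjPairs]
      refine Finset.sum_eq_zero fun x hx => Finset.sum_eq_zero fun y hy => ?_
      rw [if_neg fun hxy => hU ⟨x, hx, y, hy, hxy⟩]
    rw [this]; positivity

/-- No edge of `A` leaves `S`, so `S` splits off as a union of components, bounded by a complete
graph. -/
lemma adjPairs_le_of_closed {S : Finset V}
    (h : ∀ x ∈ S, ∀ y ∈ A, G.Adj x y → y ∈ S) :
    adjPairs G A ≤ adjPairs G (A \ S) + S.card * (S.card - 1) := by
  have hoff : S.card * (S.card - 1) = S.offDiag.card := by
    rw [Finset.offDiag_card, Nat.mul_sub_one]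
  rw [adjPairs_eq_card, adjPairs_eq_card, hoff]
  refine (Finset.card_le_card fun p hp => ?_).trans (Finset.card_union_le _ _)
  simp only [mem_filter, mem_product, mem_union, Finset.mem_sdiff, mem_offDiag] at hp ⊢
  have h1 := fun hx => h p.1 hx p.2 hp.1.2 hp.2
  have h2 := fun hx => h p.2 hx p.1 hp.1.1 hp.2.symm
  have := hp.2.ne
  tauto

/-- A graph without paths on four vertices has at most as many edges as vertices. -/
lemma adjPairs_le_two_mul (A : Finset V) (h : PathFreeOn G 4 (A : Set V)) :
    adjPairs G A ≤ 2 * A.card := by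
  induction hn : A.card using Nat.strong_induction_on generalizing A with
  | _ n ih =>
  rcases A.eq_empty_or_nonempty with rfl | ⟨a, ha⟩
  · simp [adjPairs]
  by_cases hdeg : ∃ v ∈ A, (nbrs G A v).card ≤ 1
  · obtain ⟨v, hv, hdv⟩ := hdeg
    obtain ⟨A', hA', rfl⟩ : ∃ A', v ∉ A' ∧ insert v A' = A :=
      ⟨A.erase v, by simp, Finset.insert_erase hv⟩
    rw [nbrs_insert_self] at hdv
    rw [Finset.card_insert_of_notMem hA'] at hn
    have := ih A'.card (by omega) A' (h.mono (by simp)) rfl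
    rw [adjPairs_insert hA']
    omega
  push Not at hdeg
  have hex : ∀ v ∈ A, ∀ u, ∃ w ∈ A, G.Adj v w ∧ w ≠ u := by
    intro v hv u
    obtain ⟨w, hw, hwu⟩ := Finset.exists_mem_ne (hdeg v hv) u
    rw [mem_nbrs] at hw
    exact ⟨w, hw.1, hw.2, hwu⟩
  -- With all degrees at least two, the path b, a, c goes on to some d ≠ a, and path-freeness forces
  -- d = b. Nothing can be attached to this triangle, so it splits off with 6 = 2 · 3 ordered pairs.
  obtain ⟨b, hb, hab, -⟩ := hex a ha a
  obtain ⟨c, hc, hac, hcb⟩ := hex a ha b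
  obtain ⟨d, hd, hcd, hda⟩ := hex c hc a
  have hdb : d = b := by
    have := h.four hb ha hc hd hab.symm hac hcd
    tauto
  subst hdb
  have hcl : ∀ x ∈ ({a, d, c} : Finset V), ∀ y ∈ A, G.Adj x y → y ∈ ({a, d, c} : Finset V) := by
    intro x hx y hy hxy
    simp only [mem_insert, mem_singleton] at hx ⊢
    by_contra! hne
    rcases hx with rfl | rfl | rfl
    · have := h.four hy ha hd hc hxy.symm hab hcd.symm
      have := hac.ne; tauto
    · have := h.four hy hd ha hc hxy.symm hab.symm hac
      tauto
    · have := h.four hy hc ha hd hxy.symm hac.symm hab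
      tauto
  have hsub : ({a, d, c} : Finset V) ⊆ A := by
    simp [Finset.insert_subset_iff, ha, hb, hc]
  have hS : ({a, d, c} : Finset V).card = 3 := by
    rw [Finset.card_eq_three]
    exact ⟨a, d, c, hab.ne, hac.ne, hcd.ne', rfl⟩
  have h1 := adjPairs_le_of_closed hcl
  have h2 := Finset.card_sdiff_of_subset hsub
  have h3 := Finset.card_le_card hsub
  have h4 := ih (A \ {a, d, c}).card (by omega) _
    (h.mono (by simp)) rfl
  rw [hS] at h1
  omega

/-- A cycle through all vertices of a longest path is closed under adjacency, since a neighbour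
outside it would give a longer path. The degree condition produces such a cycle on four or five
vertices. -/
lemma exists_closed_of_three_le_degree (hA : A.Nonempty) (h : PathFreeOn G 6 (A : Set V))
    (hdeg : ∀ v ∈ A, 3 ≤ (nbrs G A v).card) :
    ∃ S ⊆ A, 1 ≤ S.card ∧ S.card ≤ 5 ∧ ∀ x ∈ S, ∀ y ∈ A, G.Adj x y → y ∈ S := by
  have hex : ∀ v ∈ A, ∀ u u', ∃ w ∈ A, G.Adj v w ∧ w ≠ u ∧ w ≠ u' := by
    intro v hv u u'
    have : ∃ w ∈ nbrs G A v, w ∉ ({u, u'} : Finset V) := by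
      refine Finset.exists_mem_notMem_of_card_lt_card ?_
      exact (Finset.card_le_two).trans_lt (hdeg v hv)
    obtain ⟨w, hw, hwu⟩ := this
    simp only [mem_nbrs, mem_insert, mem_singleton, not_or] at hw hwu
    exact ⟨w, hw.1, hw.2, hwu⟩
  have cyc5 : ∀ p q r s t, p ∈ A → q ∈ A → r ∈ A → s ∈ A → t ∈ A → G.Adj p q → G.Adj q r →
      G.Adj r s → G.Adj s t → G.Adj t p → p ≠ r → p ≠ s → q ≠ s → q ≠ t → r ≠ t →
      ∃ S ⊆ A, 1 ≤ S.card ∧ S.card ≤ 5 ∧ ∀ x ∈ S, ∀ y ∈ A, G.Adj x y → y ∈ S := by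
    intro p q r s t hp hq hr hs ht hpq hqr hrs hst htp h1 h2 h3 h4 h5
    refine ⟨{p, q, r, s, t}, by simp [Finset.insert_subset_iff, *],
      Finset.card_pos.2 ⟨p, by simp⟩, Finset.card_le_five, ?_⟩
    intro x hx y hy hxy
    simp only [mem_insert, mem_singleton] at hx ⊢
    have e1 := hpq.ne
    have e2 := hqr.ne
    have e3 := hrs.ne
    have e4 := hst.ne
    have e5 := htp.ne
    rcases hx with rfl | rfl | rfl | rfl | rfl
    · have := h.six hy hp hq hr hs ht hxy.symm hpq hqr hrs hst; grind
    · have := h.six hy hq hr hs ht hp hxy.symm hqr hrs hst htp; grind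
    · have := h.six hy hr hs ht hp hq hxy.symm hrs hst htp hpq; grind
    · have := h.six hy hs ht hp hq hr hxy.symm hst htp hpq hqr; grind
    · have := h.six hy ht hp hq hr hs hxy.symm htp hpq hqr hrs; grind
  have hsub : ∀ v p q r : V, (nbrs G A v ⊆ {p, q, r}) → v ∈ A →
      G.Adj v p ∧ G.Adj v q ∧ G.Adj v r := by
    intro v p q r hv hvA
    have := Finset.eq_of_subset_of_card_le hv ((Finset.card_le_three).trans (hdeg v hvA))
    have hm : ∀ x ∈ ({p, q, r} : Finset V), G.Adj v x := fun x hx => by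
      rw [← this, mem_nbrs] at hx; exact hx.2
    exact ⟨hm p (by simp), hm q (by simp), hm r (by simp)⟩
  obtain ⟨a, ha⟩ := hA
  obtain ⟨b, hb, hab, -⟩ := hex a ha a a
  obtain ⟨c, hc, hbc, hca, -⟩ := hex b hb a a
  obtain ⟨d, hd, hcd, hda, hdb⟩ := hex c hc a b
  -- Without a path on five vertices, all neighbours of the end `a` lie among `b`, `c`, `d`; having
  -- degree three, `a` is adjacent to `d`, closing a 4-cycle.
  by_cases h5 : PathFreeOn G 5 (A : Set V)
  · have hba := hab.ne
    have hcb := hbc.ne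
    have hdc := hcd.ne
    obtain ⟨-, hac, had⟩ := hsub a b c d (by
      intro y hy
      simp only [mem_nbrs, mem_insert, mem_singleton] at hy ⊢
      have := h5.five hy.1 ha hb hc hd hy.2.symm hab hbc hcd
      have := hy.2.ne
      grind) ha
    refine ⟨{a, b, c, d}, by simp [Finset.insert_subset_iff, *],
      Finset.card_pos.2 ⟨a, by simp⟩, Finset.card_le_four.trans (by norm_num), ?_⟩
    intro x hx y hy hxy
    simp only [mem_insert, mem_singleton] at hx ⊢
    rcases hx with rfl | rfl | rfl | rfl
    · have := h5.five hy ha hb hc hd hxy.symm hab hbc hcd; grind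
    · have := h5.five hy hb hc hd ha hxy.symm hbc hcd had.symm; grind
    · have := h5.five hy hc hd ha hb hxy.symm hcd had.symm hab; grind
    · have := h5.five hy hd ha hb hc hxy.symm had.symm hab hbc; grind
  · have : ∃ a b c d e, a ∈ A ∧ b ∈ A ∧ c ∈ A ∧ d ∈ A ∧ e ∈ A ∧ G.Adj a b ∧ G.Adj b c ∧
        G.Adj c d ∧ G.Adj d e ∧ a ≠ c ∧ a ≠ d ∧ a ≠ e ∧ b ≠ d ∧ b ≠ e ∧ c ≠ e := by
      simp only [PathFreeOn, not_forall, not_not] at h5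
      obtain ⟨l, hl1, hl2, hl3, hl4⟩ := h5
      match l, hl4 with
      | [a, b, c, d, e], _ =>
        simp at hl1 hl2 hl3
        refine ⟨a, b, c, d, e, ?_⟩
        tauto
    obtain ⟨a, b, c, d, e, ha, hb, hc, hd, he, hab, hbc, hcd, hde, h1, h2, h3, h4, h5, h6⟩ := this
    by_cases hae : G.Adj e a
    · exact cyc5 a b c d e ha hb hc hd he hab hbc hcd hde hae h1 h2 h4 h5 h6
    have n1 := hab.ne
    have n2 := hbc.ne
    have n3 := hcd.ne
    have n4 := hde.ne
    obtain ⟨-, hac, had⟩ := hsub a b c d (by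
      intro y hy
      simp only [mem_nbrs, mem_insert, mem_singleton] at hy ⊢
      have := h.six hy.1 ha hb hc hd he hy.2.symm hab hbc hcd hde
      have := hy.2.ne
      have : y ≠ e := by rintro rfl; exact hae hy.2.symm
      grind) ha
    obtain ⟨heb, -, -⟩ := hsub e b c d (by
      intro y hy
      simp only [mem_nbrs, mem_insert, mem_singleton] at hy ⊢
      have := h.six ha hb hc hd he hy.1 hab hbc hcd hde hy.2
      have := hy.2.ne
      have : y ≠ a := by rintro rfl; exact hae hy.2
      grind) he
    -- Both ends are adjacent to all three inner vertices, which yields the 5-cycle a, c, b, e, d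
    -- even though `a` and `e` are not adjacent.
    exact cyc5 a c b e d ha hc hb he hd hac hbc.symm heb.symm hde.symm had.symm n1 h3 h6 n3 h4

/-- A graph without paths on six vertices has at most twice as many edges as vertices. -/
lemma adjPairs_le_four_mul (A : Finset V) (h : PathFreeOn G 6 (A : Set V)) :
    adjPairs G A ≤ 4 * A.card := by
  induction hn : A.card using Nat.strong_induction_on generalizing A with
  | _ n ih =>
  rcases A.eq_empty_or_nonempty with rfl | hA
  · simp [adjPairs]
  by_cases hdeg : ∃ v ∈ A, (nbrs G A v).card ≤ 2
  · obtain ⟨v, hv, hdv⟩ := hdeg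
    obtain ⟨A', hA', rfl⟩ : ∃ A', v ∉ A' ∧ insert v A' = A :=
      ⟨A.erase v, by simp, Finset.insert_erase hv⟩
    rw [nbrs_insert_self] at hdv
    rw [Finset.card_insert_of_notMem hA'] at hn
    have := ih A'.card (by omega) A' (h.mono (by simp)) rfl
    rw [adjPairs_insert hA']
    omega
  push Not at hdeg
  obtain ⟨S, hsub, hS1, hS5, hcl⟩ := exists_closed_of_three_le_degree hA h hdeg
  have h1 := adjPairs_le_of_closed hcl
  have h2 := Finset.card_sdiff_of_subset hsub
  have h3 := Finset.card_le_card hsub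
  have h4 := ih (A \ S).card (by omega) _ (h.mono (by simp)) rfl
  have h5 : S.card * (S.card - 1) ≤ 4 * S.card := by
    rw [mul_comm]; exact Nat.mul_le_mul_right _ (by omega)
  omega

end

end SuspendedPath

/-! ### The number of triangles lost by deleting a four-clique -/

namespace SuspendedPath

section

open Finset
open scoped Classical

variable {V : Type*} {G : SimpleGraph V}

/-- Triangles meeting the clique are sorted by whether they use one, two or three of its vertices;
the term 3 · 8 = 24 counts the ordered triangles inside the clique. -/
lemma triTriples_insert_clique {a b c d : V} {W : Finset V}
    (ha : a ∉ W) (hb : b ∉ W) (hc : c ∉ W) (hd : d ∉ W)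
    (hab : G.Adj a b) (hac : G.Adj a c) (had : G.Adj a d)
    (hbc : G.Adj b c) (hbd : G.Adj b d) (hcd : G.Adj c d) :
    triTriples G (insert a (insert b (insert c (insert d W)))) =
      triTriples G W + 3 * (adjPairs G (nbrs G W a) + adjPairs G (nbrs G W b) +
        adjPairs G (nbrs G W c) + adjPairs G (nbrs G W d) +
        2 * ((nbrs G (nbrs G W a) b).card + (nbrs G (nbrs G W a) c).card +
          (nbrs G (nbrs G W a) d).card + (nbrs G (nbrs G W b) c).card +
          (nbrs G (nbrs G W b) d).card + (nbrs G (nbrs G W c) d).card) + 8) := by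
  have n1 := hab.ne
  have n2 := hac.ne
  have n3 := had.ne
  have n4 := hbc.ne
  have n5 := hbd.ne
  have n6 := hcd.ne
  rw [triTriples_insert (by simp [*]), triTriples_insert (by simp [*]),
    triTriples_insert (by simp [*]), triTriples_insert (by simp [*]),
    nbrs_insert_of_adj hab, nbrs_insert_of_adj hac, nbrs_insert_of_adj had,
    nbrs_insert_of_adj hbc, nbrs_insert_of_adj hbd, nbrs_insert_of_adj hcd,
    adjPairs_insert (by simp [*]), adjPairs_insert (by simp [*]),
    adjPairs_insert (by simp [*]), adjPairs_insert (by simp [*]),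
    adjPairs_insert (by simp [*]), adjPairs_insert (by simp [*]),
    nbrs_insert_of_adj hbc, nbrs_insert_of_adj hbd, nbrs_insert_of_adj hcd,
    nbrs_insert_of_adj hcd]
  rw [Finset.card_insert_of_notMem (by simp [*]), Finset.card_insert_of_notMem (by simp [*]),
    Finset.card_insert_of_notMem (by simp [*]), Finset.card_insert_of_notMem (by simp [*])]
  ring

lemma card_nbrs_nbrs_eq_sum (W : Finset V) (a b : V) :
    (nbrs G (nbrs G W a) b).card = ∑ u ∈ W, if G.Adj a u ∧ G.Adj b u then 1 else 0 := by
  rw [← Finset.card_filter]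
  congr 1
  ext u
  simp [and_assoc]

lemma exists_eq_insert_clique [Fintype V] {a b c d : V}
    (hab : G.Adj a b) (hac : G.Adj a c) (had : G.Adj a d)
    (hbc : G.Adj b c) (hbd : G.Adj b d) (hcd : G.Adj c d) :
    ∃ W : Finset V, a ∉ W ∧ b ∉ W ∧ c ∉ W ∧ d ∉ W ∧ W.card + 4 = Fintype.card V ∧
      insert a (insert b (insert c (insert d W))) = univ := by
  refine ⟨univ \ {a, b, c, d}, by simp, by simp, by simp, by simp, ?_, ?_⟩
  · have h4 : ({a, b, c, d} : Finset V).card = 4 :=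
      Finset.card_eq_four.2 ⟨a, b, c, d, hab.ne, hac.ne, had.ne, hbc.ne, hbd.ne, hcd.ne, rfl⟩
    have := Finset.card_sdiff_add_card_eq_card (Finset.subset_univ ({a, b, c, d} : Finset V))
    rw [h4] at this
    exact this
  · ext x
    simp only [mem_insert, Finset.mem_sdiff, mem_univ, mem_singleton, true_and, iff_true]
    tauto

lemma LocallyPathFree.nbrs {k : ℕ} (h : LocallyPathFree G k) (W : Finset V) (v : V) :
    PathFreeOn G k (nbrs G W v : Set V) :=
  (h v).mono fun x hx => by simpa using (mem_nbrs.1 (Finset.mem_coe.1 hx)).2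

/-- An outside vertex adjacent to `i` and `j` in the clique would start a path u, j, k, l in the
neighbourhood of `i`. So each outside vertex sees at most one clique vertex, and the four
neighbourhoods in `W` have total size at most `W.card`. -/
lemma triTriples_insert_clique_le_of_pathFree_four (hG : LocallyPathFree G 4)
    {a b c d : V} {W : Finset V} (ha : a ∉ W) (hb : b ∉ W) (hc : c ∉ W) (hd : d ∉ W)
    (hab : G.Adj a b) (hac : G.Adj a c) (had : G.Adj a d)
    (hbc : G.Adj b c) (hbd : G.Adj b d) (hcd : G.Adj c d) :
    triTriples G (insert a (insert b (insert c (insert d W)))) ≤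
      triTriples G W + 6 * W.card + 24 := by
  have key : ∀ i j k l u, G.Adj i j → G.Adj i k → G.Adj i l → G.Adj j k → G.Adj k l →
      j ≠ l → u ≠ k → u ≠ l → G.Adj i u → G.Adj j u → False := by
    intro i j k l u hij hik hil hjk hkl h1 h2 h3 hi hj
    have := (hG i).four (a := u) (b := j) (c := k) (d := l) hi hij hik hil hj.symm hjk hkl
    tauto
  have hne : ∀ u ∈ W, u ≠ a ∧ u ≠ b ∧ u ≠ c ∧ u ≠ d := by
    intro u hu
    refine ⟨?_, ?_, ?_, ?_⟩ <;> rintro rfl <;> contradiction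
  have hsum : (nbrs G W a).card + (nbrs G W b).card + (nbrs G W c).card + (nbrs G W d).card +
      ((nbrs G (nbrs G W a) b).card + (nbrs G (nbrs G W a) c).card +
          (nbrs G (nbrs G W a) d).card + (nbrs G (nbrs G W b) c).card +
          (nbrs G (nbrs G W b) d).card + (nbrs G (nbrs G W c) d).card) ≤ W.card := by
    simp only [card_nbrs_nbrs_eq_sum]
    simp only [card_nbrs_eq_sum, ← Finset.sum_add_distrib]
    rw [Finset.card_eq_sum_ones]
    refine Finset.sum_le_sum fun u hu => ?_
    obtain ⟨h1, h2, h3, h4⟩ := hne u hu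
    have k1 : ¬ (G.Adj a u ∧ G.Adj b u) := fun h =>
      key a b c d u hab hac had hbc hcd hbd.ne h3 h4 h.1 h.2
    have k2 : ¬ (G.Adj a u ∧ G.Adj c u) := fun h =>
      key a c b d u hac hab had hbc.symm hbd hcd.ne h2 h4 h.1 h.2
    have k3 : ¬ (G.Adj a u ∧ G.Adj d u) := fun h =>
      key a d b c u had hab hac hbd.symm hbc hcd.ne' h2 h3 h.1 h.2
    have k4 : ¬ (G.Adj b u ∧ G.Adj c u) := fun h =>
      key b c a d u hbc hab.symm hbd hac.symm had hcd.ne h1 h4 h.1 h.2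
    have k5 : ¬ (G.Adj b u ∧ G.Adj d u) := fun h =>
      key b d a c u hbd hab.symm hbc had.symm hac hcd.ne' h1 h3 h.1 h.2
    have k6 : ¬ (G.Adj c u ∧ G.Adj d u) := fun h =>
      key c d a b u hcd hac.symm hbc.symm had.symm hab hbd.ne' h1 h2 h.1 h.2
    simp only [k1, k2, k3, k4, k5, k6, if_false]
    split_ifs <;> simp_all
  rw [triTriples_insert_clique ha hb hc hd hab hac had hbc hbd hcd]
  have e1 := adjPairs_le_two_mul _ (hG.nbrs W a)
  have e2 := adjPairs_le_two_mul _ (hG.nbrs W b)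
  have e3 := adjPairs_le_two_mul _ (hG.nbrs W c)
  have e4 := adjPairs_le_two_mul _ (hG.nbrs W d)
  omega

/-- Inside `N`, a neighbour of a vertex of `D` is a leaf. Hence edges at `D` form stars or isolated
edges, and the general bound is needed only for the vertices `R'` away from `D`; the saving is a
coefficient 1 instead of 4 on `D`. -/
lemma adjPairs_le_of_star {N D : Finset V} (hN : PathFreeOn G 6 (N : Set V))
    (h : ∀ u ∈ D, ∀ v ∈ N, ∀ w ∈ N, G.Adj u v → G.Adj v w → w = u) :
    adjPairs G N ≤ 4 * (N \ D).card + D.card := by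
  set R := (N \ D).filter fun v => ∃ u ∈ D, G.Adj u v with hR
  set R' := (N \ D).filter fun v => ¬ ∃ u ∈ D, G.Adj u v with hR'
  have hcard : R.card + R'.card = (N \ D).card := Finset.card_filter_add_card_filter_not _
  have h0 : adjPairs G R' ≤ 4 * R'.card := adjPairs_le_four_mul _ (hN.mono (by
    intro x hx
    simp only [hR', coe_filter, Set.mem_ofPred_eq, Finset.mem_sdiff] at hx
    exact hx.1.1))
  set P := (N ×ˢ N).filter fun p => G.Adj p.1 p.2 with hP
  have h1 : (P.filter fun p => p.1 ∈ R).card ≤ R.card := by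
    refine Finset.card_le_card_of_injOn Prod.fst (by intro p; simp) ?_
    rintro ⟨v, w⟩ hp ⟨v', w'⟩ hp' (rfl : v = v')
    simp only [hP, hR, coe_filter, mem_filter, mem_product, Finset.mem_sdiff,
      Set.mem_ofPred_eq] at hp hp'
    obtain ⟨u, hu, huv⟩ := hp.2.2
    rw [h u hu v hp.2.1.1 w hp.1.1.2 huv hp.1.2, h u hu v hp.2.1.1 w' hp'.1.1.2 huv hp'.1.2]
  have h2 : (P.filter fun p => p.2 ∈ R).card ≤ R.card := by
    refine Finset.card_le_card_of_injOn Prod.snd (by intro p; simp) ?_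
    rintro ⟨w, v⟩ hp ⟨w', v'⟩ hp' (rfl : v = v')
    simp only [hP, hR, coe_filter, mem_filter, mem_product, Finset.mem_sdiff,
      Set.mem_ofPred_eq] at hp hp'
    obtain ⟨u, hu, huv⟩ := hp.2.2
    rw [h u hu v hp.2.1.1 w hp.1.1.1 huv hp.1.2.symm,
      h u hu v hp.2.1.1 w' hp'.1.1.1 huv hp'.1.2.symm]
  have h3 : (P.filter fun p => p.1 ∈ D ∧ p.2 ∈ D).card ≤ D.card := by
    refine Finset.card_le_card_of_injOn Prod.fst (by intro p; simp; tauto) ?_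
    rintro ⟨v, w⟩ hp ⟨v', w'⟩ hp' (rfl : v = v')
    simp only [hP, coe_filter, mem_filter, mem_product, Set.mem_ofPred_eq] at hp hp'
    rw [h w hp.2.2 v hp.1.1.1 w' hp'.1.1.2 hp.1.2.symm hp'.1.2]
  have hunion : P ⊆ ((R' ×ˢ R').filter fun p => G.Adj p.1 p.2) ∪ ((P.filter fun p => p.1 ∈ R) ∪
      ((P.filter fun p => p.2 ∈ R) ∪ P.filter fun p => p.1 ∈ D ∧ p.2 ∈ D)) := by
    rintro ⟨v, w⟩ hp
    simp only [hP, hR, hR', mem_filter, mem_product, mem_union, Finset.mem_sdiff] at hp ⊢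
    have := hp.2.symm
    grind
  have hle := (Finset.card_le_card hunion).trans ((Finset.card_union_le _ _).trans
    (Nat.add_le_add_left ((Finset.card_union_le _ _).trans
      (Nat.add_le_add_left (Finset.card_union_le _ _) _)) _))
  rw [← adjPairs_eq_card, ← adjPairs_eq_card] at hle
  omega

/-- If u is also adjacent to `j`, a path w, v, u in the neighbourhood of `i` would continue through
`j`, `k`, `l` to six vertices. So the neighbours shared with another clique vertex can serve as `D`
in `adjPairs_le_of_star`. -/
lemma adjPairs_nbrs_le_of_clique (hG : LocallyPathFree G 6) {i j k l : V} {W : Finset V}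
    (hj : j ∉ W) (hk : k ∉ W) (hl : l ∉ W)
    (hij : G.Adj i j) (hik : G.Adj i k) (hil : G.Adj i l)
    (hjk : G.Adj j k) (hjl : G.Adj j l) (hkl : G.Adj k l) :
    adjPairs G (nbrs G W i) ≤ ∑ u ∈ W, if G.Adj i u then
      (if G.Adj j u ∨ G.Adj k u ∨ G.Adj l u then 1 else 4) else 0 := by
  have aux : ∀ p q r, p ∉ W → q ∉ W → r ∉ W → G.Adj i p → G.Adj i q → G.Adj i r → G.Adj p q →
      G.Adj q r → p ≠ r → ∀ u ∈ nbrs G W i, G.Adj p u → ∀ v ∈ nbrs G W i, ∀ w ∈ nbrs G W i,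
      G.Adj u v → G.Adj v w → w = u := by
    intro p q r hp hq hr hip hiq hir hpq hqr hpr u hu hpu v hv w hw huv hvw
    rw [mem_nbrs] at hu hv hw
    have := (hG i).six hw.2 hv.2 hu.2 hip hiq hir hvw.symm huv.symm hpu.symm hpq hqr
    grind
  refine (adjPairs_le_of_star (D := (nbrs G W i).filter fun u =>
    G.Adj j u ∨ G.Adj k u ∨ G.Adj l u) (hG.nbrs W i) ?_).trans ?_
  · intro u hu v hv w hw huv hvw
    rw [mem_filter] at hu
    rcases hu.2 with h | h | h
    · exact aux j k l hj hk hl hij hik hil hjk hkl hjl.ne u hu.1 h v hv w hw huv hvw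
    · exact aux k j l hk hj hl hik hij hil hjk.symm hjl hkl.ne u hu.1 h v hv w hw huv hvw
    · exact aux l j k hl hj hk hil hij hik hjl.symm hjk hkl.ne' u hu.1 h v hv w hw huv hvw
  · rw [← Finset.filter_not, Finset.card_filter, Finset.card_filter, Finset.mul_sum,
      ← Finset.sum_add_distrib, nbrs, Finset.sum_filter]
    refine Finset.sum_le_sum fun u _ => ?_
    split_ifs <;> simp_all

/-- The vertices of `W` with at least three neighbours among `a`, `b`, `c`, `d`. -/
noncomputable def threeAttached (G : SimpleGraph V) (W : Finset V) (a b c d : V) : Finset V :=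
  W.filter fun u => (G.Adj a u ∧ G.Adj b u ∧ G.Adj c u) ∨ (G.Adj a u ∧ G.Adj b u ∧ G.Adj d u) ∨
    (G.Adj a u ∧ G.Adj c u ∧ G.Adj d u) ∨ (G.Adj b u ∧ G.Adj c u ∧ G.Adj d u)

lemma triTriples_insert_clique_le_of_pathFree_six (hG : LocallyPathFree G 6)
    {a b c d : V} {W : Finset V} (ha : a ∉ W) (hb : b ∉ W) (hc : c ∉ W) (hd : d ∉ W)
    (hab : G.Adj a b) (hac : G.Adj a c) (had : G.Adj a d)
    (hbc : G.Adj b c) (hbd : G.Adj b d) (hcd : G.Adj c d) :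
    triTriples G (insert a (insert b (insert c (insert d W)))) ≤
      triTriples G W + 12 * W.card + 36 * (threeAttached G W a b c d).card + 24 := by
  rw [triTriples_insert_clique ha hb hc hd hab hac had hbc hbd hcd]
  have e1 := adjPairs_nbrs_le_of_clique hG hb hc hd hab hac had hbc hbd hcd
  have e2 := adjPairs_nbrs_le_of_clique hG ha hc hd hab.symm hbc hbd hac had hcd
  have e3 := adjPairs_nbrs_le_of_clique hG ha hb hd hac.symm hbc.symm hcd hab had hbd
  have e4 := adjPairs_nbrs_le_of_clique hG ha hb hc had.symm hbd.symm hcd.symm hab hac hbc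
  have hsum : adjPairs G (nbrs G W a) + adjPairs G (nbrs G W b) +
        adjPairs G (nbrs G W c) + adjPairs G (nbrs G W d) +
        2 * ((nbrs G (nbrs G W a) b).card + (nbrs G (nbrs G W a) c).card +
          (nbrs G (nbrs G W a) d).card + (nbrs G (nbrs G W b) c).card +
          (nbrs G (nbrs G W b) d).card + (nbrs G (nbrs G W c) d).card) ≤
      4 * W.card + 12 * (threeAttached G W a b c d).card := by
    refine (Nat.add_le_add_right (add_le_add (add_le_add (add_le_add e1 e2) e3) e4) _).trans ?_
    simp only [card_nbrs_nbrs_eq_sum, threeAttached, Finset.card_filter,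
      Finset.card_eq_sum_ones W, Finset.mul_sum, ← Finset.sum_add_distrib]
    refine Finset.sum_le_sum fun u _ => ?_
    -- A vertex seeing 0, 1, 2, 3 or 4 clique vertices contributes at most 0, 4, 2 + 2, 3 + 6 or 4 +
    -- 12, so the surcharge 12 is needed only from three on.
    by_cases p1 : G.Adj a u <;> by_cases p2 : G.Adj b u <;> by_cases p3 : G.Adj c u <;>
      by_cases p4 : G.Adj d u <;> simp [p1, p2, p3, p4]
  omega

end

end SuspendedPath

/-! ### Light apexes of four-cliques and heavy triangles -/

namespace SuspendedPath

section

open Finset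
open scoped Classical

variable {V : Type*} [Fintype V] {G : SimpleGraph V}

/-- The number of common neighbours of `x` and `y`. -/
noncomputable def codeg (G : SimpleGraph V) (x y : V) : ℕ :=
  (univ.filter fun z => G.Adj x z ∧ G.Adj y z).card

lemma codeg_comm (x y : V) : codeg G x y = codeg G y x := by
  simp only [codeg, and_comm]

/-- Every four-clique has a vertex whose three edges in the clique lie in at most two triangles. -/
def HasLightApexes (G : SimpleGraph V) : Prop :=
  ∀ κ : Fin 4 → V, (∀ i j, i ≠ j → G.Adj (κ i) (κ j)) →
    ∃ m, ∀ i, i ≠ m → codeg G (κ m) (κ i) ≤ 2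

lemma HasLightApexes.of_clique (h : HasLightApexes G) {a b c d : V}
    (hab : G.Adj a b) (hac : G.Adj a c) (had : G.Adj a d)
    (hbc : G.Adj b c) (hbd : G.Adj b d) (hcd : G.Adj c d) :
    (codeg G a b ≤ 2 ∧ codeg G a c ≤ 2 ∧ codeg G a d ≤ 2) ∨
    (codeg G a b ≤ 2 ∧ codeg G b c ≤ 2 ∧ codeg G b d ≤ 2) ∨
    (codeg G a c ≤ 2 ∧ codeg G b c ≤ 2 ∧ codeg G c d ≤ 2) ∨
    (codeg G a d ≤ 2 ∧ codeg G b d ≤ 2 ∧ codeg G c d ≤ 2) := by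
  obtain ⟨m, hm⟩ := h ![a, b, c, d] (by
    simp [Fin.forall_fin_succ, hab, hac, had, hbc, hbd, hcd, hab.symm, hac.symm, had.symm,
      hbc.symm, hbd.symm, hcd.symm])
  have h0 := hm 0
  have h1 := hm 1
  have h2 := hm 2
  have h3 := hm 3
  fin_cases m
  · simp at h1 h2 h3; tauto
  · simp [codeg_comm b a] at h0 h2 h3; tauto
  · simp [codeg_comm c a, codeg_comm c b] at h0 h1 h3; tauto
  · simp [codeg_comm d a, codeg_comm d b, codeg_comm d c] at h0 h1 h2; tauto

/-- Let `μ s` be a clique vertex that `u s` is allowed to miss. If these differ, a six-vertex path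
through the clique and the `u s` lies in one clique vertex's neighbourhood. If all agree, the common
missed vertex is the light apex. -/
lemma exists_light_apex (hG : LocallyPathFree G 6) {κ : Fin 4 → V}
    (hκ : ∀ i j, i ≠ j → G.Adj (κ i) (κ j)) {u : Fin 3 → V} (hu : Function.Injective u)
    (huκ : ∀ s i, u s ≠ κ i) (h : ∀ s, ∃ m, ∀ i, i ≠ m → G.Adj (κ i) (u s)) :
    ∃ m, ∀ i, i ≠ m → codeg G (κ m) (κ i) ≤ 2 := by
  choose μ hμ using h
  have hinj : ∀ i j, i ≠ j → κ i ≠ κ j := fun i j hij => (hκ i j hij).ne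
  by_cases hne : ∃ s t, μ s ≠ μ t
  · exfalso
    obtain ⟨s, t, hst⟩ := hne
    obtain ⟨r, hrs, hrt⟩ : ∃ r, r ≠ s ∧ r ≠ t := by
      have : ∀ s t : Fin 3, ∃ r, r ≠ s ∧ r ≠ t := by decide
      exact this s t
    have hst' : s ≠ t := fun h => hst (by rw [h])
    -- `p` is the hub whose neighbourhood contains the path, so all three outside vertices must see
    -- it.
    obtain ⟨p, q, hpq, hps, hpt, hqs, hqt, hpr⟩ :
        ∃ p q, p ≠ q ∧ p ≠ μ s ∧ p ≠ μ t ∧ q ≠ μ s ∧ q ≠ μ t ∧ p ≠ μ r := by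
      have : ∀ a b c : Fin 4, a ≠ b → ∃ p q, p ≠ q ∧ p ≠ a ∧ p ≠ b ∧ q ≠ a ∧ q ≠ b ∧ p ≠ c := by
        decide
      exact this _ _ _ hst
    have hs : ∀ {i}, i ≠ μ s → G.Adj (κ i) (u s) := fun h => hμ s _ h
    have ht : ∀ {i}, i ≠ μ t → G.Adj (κ i) (u t) := fun h => hμ t _ h
    have n1 := hu.ne hst'
    have n2 := hu.ne hrs
    have n3 := hu.ne hrt
    have n4 := hinj _ _ hst
    have n5 := hinj _ _ hqs
    have n6 := hinj _ _ hqt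
    -- The path on `κ (μ s)`, `u t`, `κ q`, `u s`, `κ (μ t)` is extended by `u r` at whichever end
    -- `u r` sees.
    by_cases hr : μ r = μ s
    · have := (hG (κ p)).six (a := κ (μ s)) (b := u t) (c := κ q) (d := u s) (e := κ (μ t))
        (f := u r) (hκ _ _ hps) (ht hpt) (hκ _ _ hpq) (hs hps) (hκ _ _ hpt) (hμ r _ hpr)
        (ht hst) (ht hqt).symm (hs hqs) (hs hst.symm).symm (hμ r _ (by rw [hr]; exact hst.symm))
      grind
    · have := (hG (κ p)).six (a := u r) (b := κ (μ s)) (c := u t) (d := κ q) (e := u s)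
        (f := κ (μ t)) (hμ r _ hpr) (hκ _ _ hps) (ht hpt) (hκ _ _ hpq) (hs hps) (hκ _ _ hpt)
        (hμ r _ (Ne.symm hr)).symm
        (ht hst) (ht hqt).symm (hs hqs) (hs hst.symm).symm
      grind
  · push Not at hne
    refine ⟨μ 0, fun i hi => ?_⟩
    obtain ⟨j, k, hjk, hji, hjm, hki, hkm⟩ : ∃ j k, j ≠ k ∧ j ≠ i ∧ j ≠ μ 0 ∧ k ≠ i ∧ k ≠ μ 0 := by
      have : ∀ a b : Fin 4, ∃ p q, p ≠ q ∧ p ≠ a ∧ p ≠ b ∧ q ≠ a ∧ q ≠ b := by decide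
      exact this _ _
    have hadj : ∀ s i, i ≠ μ 0 → G.Adj (κ i) (u s) := fun s i hi => hμ s i (by rwa [hne s 0])
    have hsub : (univ.filter fun z => G.Adj (κ (μ 0)) z ∧ G.Adj (κ i) z) ⊆ {κ j, κ k} := by
      intro w hw
      simp only [mem_filter, mem_univ, true_and, mem_insert, mem_singleton] at hw ⊢
      -- A further common neighbour `w` may itself be one of the three outside vertices; two others
      -- remain for the path.
      obtain ⟨s, t, hst, hsw, htw⟩ : ∃ s t, s ≠ t ∧ w ≠ u s ∧ w ≠ u t := by
        by_cases h0 : w = u 0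
        · exact ⟨1, 2, by decide, by rw [h0]; exact hu.ne (by decide),
            by rw [h0]; exact hu.ne (by decide)⟩
        by_cases h1 : w = u 1
        · exact ⟨0, 2, by decide, h0, by rw [h1]; exact hu.ne (by decide)⟩
        · exact ⟨0, 1, by decide, h0, h1⟩
      have := (hG (κ i)).six (a := w) (b := κ (μ 0)) (c := κ j) (d := u s) (e := κ k) (f := u t)
        hw.2 (hκ _ _ hi) (hκ _ _ hji.symm) (hadj s i hi) (hκ _ _ hki.symm) (hadj t i hi)
        hw.1.symm (hκ _ _ hjm.symm) (hadj s j hjm) (hadj s k hkm).symm (hadj t k hkm)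
      have n1 := hu.ne hst
      have n2 := hinj _ _ hjk
      have n3 := hinj _ _ hkm
      grind
    exact (Finset.card_le_card hsub).trans Finset.card_le_two

/-- Double counting of a symmetric family of triangles along weighted edges. -/
lemma mul_card_triples_le {T : V → V → V → Prop} (hT₁ : ∀ x y z, T x y z → T y x z)
    (hT₂ : ∀ x y z, T x y z → T x z y) {w : V → V → ℕ}
    {L : SimpleGraph V} {C r : ℕ}
    (hw : ∀ x y, w x y * (univ.filter fun z => T x y z).card ≤ if L.Adj x y then C else 0)
    (hr : ∀ x y z, T x y z → r ≤ w x y + w x z + w y z) :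
    r * (∑ x : V, ∑ y : V, ∑ z : V, if T x y z then 1 else 0) ≤ 3 * C * adjPairs L univ := by
  have i1 : ∀ x y z, T x y z ↔ T y x z := fun x y z => ⟨hT₁ _ _ _, hT₁ _ _ _⟩
  have i2 : ∀ x y z, T x y z ↔ T x z y := fun x y z => ⟨hT₂ _ _ _, hT₂ _ _ _⟩
  set S := ∑ x : V, ∑ y : V, ∑ z : V, if T x y z then w x y else 0 with hS
  have hS1 : ∑ x : V, ∑ y : V, ∑ z : V, (if T x y z then w x z else 0) = S := by
    refine Finset.sum_congr rfl fun x _ => ?_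
    rw [Finset.sum_comm]
    simp only [i2 x]
  have hS2 : ∑ x : V, ∑ y : V, ∑ z : V, (if T x y z then w y z else 0) = S := by
    rw [Finset.sum_comm, ← hS1]
    simp only [i1]
  have hS3 : S ≤ C * adjPairs L univ := by
    rw [hS, adjPairs, Finset.mul_sum]
    refine Finset.sum_le_sum fun x _ => ?_
    rw [Finset.mul_sum]
    refine Finset.sum_le_sum fun y _ => ?_
    have := hw x y
    rw [Finset.card_filter, Finset.mul_sum] at this
    simpa using this
  calc r * (∑ x : V, ∑ y : V, ∑ z : V, if T x y z then 1 else 0)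
      ≤ ∑ x : V, ∑ y : V, ∑ z : V, ((if T x y z then w x y else 0) +
          (if T x y z then w x z else 0) + (if T x y z then w y z else 0)) := by
        simp only [Finset.mul_sum]
        refine Finset.sum_le_sum fun x _ => Finset.sum_le_sum fun y _ =>
          Finset.sum_le_sum fun z _ => ?_
        split_ifs with h
        · simpa using hr x y z h
        · simp
    _ = S + S + S := by
        simp only [Finset.sum_add_distrib, hS1, hS2]; rfl
    _ ≤ 3 * C * adjPairs L univ := by linarith

/-- A triangle with no edge in only one triangle and at most one edge in only two triangles. -/
def IsHeavyTriangle (G : SimpleGraph V) (x y z : V) : Prop :=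
  G.Adj x y ∧ G.Adj x z ∧ G.Adj y z ∧ 2 ≤ codeg G x y ∧ 2 ≤ codeg G x z ∧ 2 ≤ codeg G y z ∧
    (3 ≤ codeg G x y ∨ 3 ≤ codeg G x z) ∧ (3 ≤ codeg G x y ∨ 3 ≤ codeg G y z) ∧
    (3 ≤ codeg G x z ∨ 3 ≤ codeg G y z)

lemma IsHeavyTriangle.swap {x y z : V} (h : IsHeavyTriangle G x y z) :
    IsHeavyTriangle G y x z := by
  obtain ⟨h1, h2, h3, h4, h5, h6, h7, h8, h9⟩ := h
  rw [codeg_comm x y] at *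
  exact ⟨h1.symm, h3, h2, h4, h6, h5, h8, h7, h9.symm⟩

lemma IsHeavyTriangle.swap_right {x y z : V} (h : IsHeavyTriangle G x y z) :
    IsHeavyTriangle G x z y := by
  obtain ⟨h1, h2, h3, h4, h5, h6, h7, h8, h9⟩ := h
  rw [codeg_comm y z] at *
  exact ⟨h2, h1, h3.symm, h5, h4, h6, h7.symm, h9, h8⟩

/-- The number of heavy triangles on an edge. -/
noncomputable def heavyCodeg (G : SimpleGraph V) (x y : V) : ℕ :=
  (univ.filter fun z => IsHeavyTriangle G x y z).card

lemma heavyCodeg_comm (x y : V) : heavyCodeg G x y = heavyCodeg G y x := by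
  unfold heavyCodeg
  congr 1
  ext z
  simp only [mem_filter, mem_univ, true_and]
  exact ⟨IsHeavyTriangle.swap, IsHeavyTriangle.swap⟩

/-- Otherwise the four vertices form a clique, and its light apex would have two edges of codegree
at most two inside one of the two heavy triangles. -/
lemma IsHeavyTriangle.not_adj (hA : HasLightApexes G) {x y a b : V}
    (ha : IsHeavyTriangle G x y a) (hb : IsHeavyTriangle G x y b) : ¬ G.Adj a b := by
  intro hab
  obtain ⟨a1, a2, a3, a4, a5, a6, a7, a8, a9⟩ := ha
  obtain ⟨b1, b2, b3, b4, b5, b6, b7, b8, b9⟩ := hb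
  have := hA.of_clique a1 a2 b2 a3 b3 hab
  omega

lemma exists_common_nbr {x y : V} (S : Finset V) (h : S.card < codeg G x y) :
    ∃ w ∉ S, G.Adj x w ∧ G.Adj y w := by
  obtain ⟨w, hw, hwS⟩ := Finset.exists_mem_notMem_of_card_lt_card h
  simp only [mem_filter, mem_univ, true_and] at hw
  exact ⟨w, hwS, hw⟩

/-- Were it false, there would be further heavy apexes `a`, `a'` on `zx` and `b` on `zy`.
Non-adjacency of apexes over the same edge keeps vertices distinct, and each adjacency pattern
between `b` and `a`, `a'` yields a six-vertex path in the neighbourhood of `z`. -/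
lemma IsHeavyTriangle.heavyCodeg_le (hG : LocallyPathFree G 6) (hA : HasLightApexes G)
    {x y z : V} (h : IsHeavyTriangle G z x y) (hy : 3 ≤ codeg G z y)
    (hx : 3 ≤ heavyCodeg G z x) : heavyCodeg G z y ≤ 1 := by
  by_contra! hy'
  obtain ⟨a, ha, hay, a', ha', ha'y, haa'⟩ : ∃ a, IsHeavyTriangle G z x a ∧ a ≠ y ∧
      ∃ a', IsHeavyTriangle G z x a' ∧ a' ≠ y ∧ a ≠ a' := by
    have h1 : 1 < ((univ.filter fun w => IsHeavyTriangle G z x w).erase y).card := by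
      rw [Finset.card_erase_of_mem (by simpa using h)]
      unfold heavyCodeg at hx
      omega
    obtain ⟨a, ha, a', ha', hne⟩ := Finset.one_lt_card.1 h1
    simp only [mem_erase, mem_filter, mem_univ, true_and] at ha ha'
    exact ⟨a, ha.2, ha.1, a', ha'.2, ha'.1, hne⟩
  obtain ⟨b, hb, hbx⟩ : ∃ b, IsHeavyTriangle G z y b ∧ b ≠ x := by
    obtain ⟨b, hb, hbx⟩ := Finset.exists_mem_ne hy' x
    exact ⟨b, by simpa using hb, hbx⟩
  have n1 := ha.not_adj hA h
  have n2 := ha'.not_adj hA h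
  have n3 := ha.not_adj hA ha'
  have n4 := hb.not_adj hA h.swap_right
  obtain ⟨hzx, hza, hxa, -, ka, -⟩ := ha
  obtain ⟨-, hza', hxa', -, ka', -⟩ := ha'
  obtain ⟨hzy, hzb, hyb, -, kb, -⟩ := hb
  obtain ⟨-, -, hxy, -⟩ := h
  have hba : b ≠ a := by rintro rfl; exact n1 hyb.symm
  have hba' : b ≠ a' := by rintro rfl; exact n2 hyb.symm
  obtain ⟨g, hg, hzg, hyg⟩ := exists_common_nbr {x, b} (Finset.card_le_two.trans_lt hy)
  -- Both apexes see `b`: the path is g, y, x, p, b, q.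
  have hcyc : ∀ {p q}, p ≠ q → p ≠ y → q ≠ y → G.Adj z p → G.Adj z q → G.Adj x p → G.Adj x q → G.Adj p b →
      G.Adj q b → ¬ G.Adj p y → ¬ G.Adj q y → False := by
    intro p q hpq hpy' hqy' hp hq hxp hxq hpb hqb hpy hqy
    have := (hG z).six hzg hzy hzx hp hzb hq hyg.symm hxy.symm hxp hpb hqb.symm
    have := hyg.symm
    simp only [mem_insert, mem_singleton, not_or] at hg
    grind
  -- If only `p` sees `b`, a second common neighbour α of `z` and `q` gives the path α, q, x, p, b,
  -- y.
  have hdeg : ∀ {p q}, p ≠ q → p ≠ y → q ≠ y → G.Adj z p → G.Adj z q → G.Adj x p → G.Adj x q → G.Adj p b →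
      ¬ G.Adj p y → ¬ G.Adj q y → ¬ G.Adj p q → b ≠ q → 2 ≤ codeg G z q → False := by
    intro p q hpq hpy' hqy' hp hq hxp hxq hpb hpy hqy hpq' hbq hk
    by_cases hqb : G.Adj q b
    · exact hcyc hpq hpy' hqy' hp hq hxp hxq hpb hqb hpy hqy
    obtain ⟨α, hα, hzα, hqα⟩ := exists_common_nbr {x} ((Finset.card_singleton x).trans_lt hk)
    have := (hG z).six hzα hq hzx hp hzb hzy hqα.symm hxq.symm hxp hpb hyb.symm
    simp only [mem_singleton] at hα
    have := hxy.symm.ne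
    have : ¬ G.Adj q p := fun h => hpq' h.symm
    have hαy : α ≠ y := by rintro rfl; exact hqy hqα
    clear hcyc
    grind
  by_cases hab : G.Adj a b
  · exact hdeg haa' hay ha'y hza hza' hxa hxa' hab n1 n2 n3 hba' ka'
  by_cases hab' : G.Adj a' b
  · exact hdeg haa'.symm ha'y hay hza' hza hxa' hxa hab' n2 n1 (fun h => n3 h.symm) hba ka
  -- Neither sees `b`: the path α, a, x, y, b, β forces α = β, after which a', x, a, α, b, y is a
  -- path.
  obtain ⟨α, hα, hzα, haα⟩ := exists_common_nbr {x} ((Finset.card_singleton x).trans_lt ka)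
  obtain ⟨β, hβ, hzβ, hbβ⟩ := exists_common_nbr {y} ((Finset.card_singleton y).trans_lt kb)
  simp only [mem_singleton] at hα hβ
  have p1 := (hG z).six hzα hza hzx hzy hzb hzβ haα.symm hxa.symm hxy hyb hbβ
  have hβx : β ≠ x := by rintro rfl; exact n4 hbβ
  have hβa : β ≠ a := by rintro rfl; exact hab hbβ.symm
  have hβa' : β ≠ a' := by rintro rfl; exact hab' hbβ.symm
  have hαy : α ≠ y := by rintro rfl; exact n1 haα
  have hαb : α ≠ b := by rintro rfl; exact hab haα
  have hαβ : α = β := by grind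
  subst hαβ
  have := (hG z).six hza' hzx hza hzα hzb hzy hxa'.symm hxa haα hbβ.symm hyb.symm
  have := hxy.ne
  grind

end

end SuspendedPath

/-! ### Charging triangles to edges: the bounds for k = 5 and k = 3 -/

namespace SuspendedPath

section

open Finset
open scoped Classical

variable {V : Type*} {G : SimpleGraph V}

lemma triTriples_comap_val (W : Finset V) :
    triTriples (G.comap (Subtype.val : W → V)) univ = triTriples G W := by
  simp only [triTriples, SimpleGraph.comap_adj]
  rw [← Finset.sum_coe_sort W]
  refine Finset.sum_congr rfl fun x _ => ?_
  rw [← Finset.sum_coe_sort W]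
  refine Finset.sum_congr rfl fun y _ => ?_
  rw [← Finset.sum_coe_sort W]

lemma LocallyPathFree.comap_val {k : ℕ} (h : LocallyPathFree G k) (W : Finset V) :
    LocallyPathFree (G.comap (Subtype.val : W → V)) k := by
  intro z l h1 h2 h3 h4
  refine h z (l.map Subtype.val) (h1.map Subtype.val_injective) ?_ ?_ (by simpa using h4)
  · rw [List.isChain_map]
    exact h2
  · intro x hx
    obtain ⟨y, hy, rfl⟩ := List.mem_map.1 hx
    exact h3 y hy

variable [Fintype V]

/-- The spanning subgraph of the edges of `G` of codegree at most `c`. -/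
def lightGraph (G : SimpleGraph V) (c : ℕ) : SimpleGraph V where
  Adj x y := G.Adj x y ∧ codeg G x y ≤ c
  symm := ⟨fun x y h => ⟨h.1.symm, by rw [codeg_comm]; exact h.2⟩⟩
  loopless := ⟨fun _ h => G.irrefl h.1⟩

/-- The spanning subgraph of the edges of `G` of codegree at least three which lie in at most two
heavy triangles. -/
def sparseHeavyGraph (G : SimpleGraph V) : SimpleGraph V where
  Adj x y := G.Adj x y ∧ 3 ≤ codeg G x y ∧ heavyCodeg G x y ≤ 2
  symm := ⟨fun x y h => ⟨h.1.symm, by rw [codeg_comm]; exact h.2.1,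
    by rw [heavyCodeg_comm]; exact h.2.2⟩⟩
  loopless := ⟨fun _ h => G.irrefl h.1⟩

lemma card_inter_nbrs_le_codeg {L : SimpleGraph V} (hL : L ≤ G) (W : Finset V) (x y : V) :
    (nbrs L W x ∩ nbrs L W y).card ≤ codeg G x y := by
  refine Finset.card_le_card fun z => ?_
  simp only [mem_inter, mem_nbrs, mem_filter, mem_univ, true_and]
  exact fun h => ⟨hL h.1.2, hL h.2.2⟩

lemma lightGraph_le (c : ℕ) : lightGraph G c ≤ G := fun _ _ h => h.1

lemma two_mul_adjPairs_lightGraph_le (c : ℕ) :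
    2 * adjPairs (lightGraph G c) univ ≤
      Fintype.card V ^ 2 + 2 * (c + 1) * Fintype.card V := by
  refine two_mul_adjPairs_le univ ?_
  rintro W - ⟨x, hx, y, hy, hxy⟩
  exact ⟨x, hx, y, hy, hxy, (card_inter_nbrs_le_codeg (lightGraph_le c) W x y).trans hxy.2⟩

/-- If `W` spans a light edge, that edge has codegree at most two. Otherwise all edges of the union
inside `W` have codegree at least three, so their common neighbours in it complete heavy triangles,
of which a sparse edge has at most two. -/
lemma two_mul_adjPairs_sup_le :
    2 * adjPairs (lightGraph G 2 ⊔ sparseHeavyGraph G) univ ≤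
      Fintype.card V ^ 2 + 6 * Fintype.card V := by
  refine (two_mul_adjPairs_le (c := 2) univ ?_).trans_eq (by simp [Finset.card_univ])
  have hle : lightGraph G 2 ⊔ sparseHeavyGraph G ≤ G :=
    sup_le (fun _ _ h => h.1) (fun _ _ h => h.1)
  rintro W - ⟨x, hx, y, hy, hxy⟩
  by_cases hlight : ∃ x ∈ W, ∃ y ∈ W, (lightGraph G 2).Adj x y
  · obtain ⟨x, hx, y, hy, hxy⟩ := hlight
    exact ⟨x, hx, y, hy, .inl hxy, (card_inter_nbrs_le_codeg hle W x y).trans hxy.2⟩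
  have hheavy : ∀ x ∈ W, ∀ y ∈ W, (lightGraph G 2 ⊔ sparseHeavyGraph G).Adj x y →
      G.Adj x y ∧ 3 ≤ codeg G x y ∧ heavyCodeg G x y ≤ 2 := fun x hx y hy h =>
    h.resolve_left fun h => hlight ⟨x, hx, y, hy, h⟩
  obtain ⟨h1, h2, h3⟩ := hheavy x hx y hy hxy
  refine ⟨x, hx, y, hy, hxy, (Finset.card_le_card fun z hz => ?_).trans h3⟩
  simp only [mem_inter, mem_nbrs, mem_filter, mem_univ, true_and] at hz ⊢
  obtain ⟨k1, k2, -⟩ := hheavy x hx z hz.1.1 hz.1.2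
  obtain ⟨l1, l2, -⟩ := hheavy y hy z hz.1.1 hz.2.2
  exact ⟨h1, k1, l1, by omega, by omega, by omega, .inl h2, .inl h2, .inl k2⟩

lemma adjPairs_sup_eq :
    adjPairs (lightGraph G 2 ⊔ sparseHeavyGraph G) univ =
      adjPairs (lightGraph G 2) univ + adjPairs (sparseHeavyGraph G) univ := by
  simp only [adjPairs, ← Finset.sum_add_distrib]
  refine Finset.sum_congr rfl fun x _ => Finset.sum_congr rfl fun y _ => ?_
  have hdisj : ¬ ((lightGraph G 2).Adj x y ∧ (sparseHeavyGraph G).Adj x y) := by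
    rintro ⟨⟨-, h1⟩, -, h2, -⟩
    omega
  rw [SimpleGraph.sup_adj]
  by_cases h1 : (lightGraph G 2).Adj x y <;> by_cases h2 : (sparseHeavyGraph G).Adj x y <;>
    simp_all

/-- A triangle which is not heavy. -/
def IsMildTriangle (G : SimpleGraph V) (x y z : V) : Prop :=
  (G.Adj x y ∧ G.Adj x z ∧ G.Adj y z) ∧ ¬ IsHeavyTriangle G x y z

lemma triTriples_univ_eq {T : V → V → V → Prop}
    (h : ∀ x y z, T x y z ↔ G.Adj x y ∧ G.Adj x z ∧ G.Adj y z) :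
    triTriples G univ = ∑ x : V, ∑ y : V, ∑ z : V, if T x y z then 1 else 0 := by
  refine Finset.sum_congr rfl fun x _ => Finset.sum_congr rfl fun y _ =>
    Finset.sum_congr rfl fun z _ => ?_
  by_cases hT : T x y z
  · rw [if_pos hT, if_pos ((h x y z).1 hT)]
  · rw [if_neg hT, if_neg fun h' => hT ((h x y z).2 h')]

lemma two_mul_triTriples_le_of_hasLightApexes (hG : LocallyPathFree G 6)
    (hA : HasLightApexes G) :
    2 * triTriples G univ ≤ 3 * Fintype.card V ^ 2 + 18 * Fintype.card V := by
  have hsplit : triTriples G univ =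
      (∑ x : V, ∑ y : V, ∑ z : V,
        if IsMildTriangle G x y z then 1 else 0) +
      ∑ x : V, ∑ y : V, ∑ z : V, if IsHeavyTriangle G x y z then 1 else 0 := by
    simp only [triTriples, ← Finset.sum_add_distrib]
    refine Finset.sum_congr rfl fun x _ => Finset.sum_congr rfl fun y _ =>
      Finset.sum_congr rfl fun z _ => ?_
    have : IsHeavyTriangle G x y z → G.Adj x y ∧ G.Adj x z ∧ G.Adj y z :=
      fun h => ⟨h.1, h.2.1, h.2.2.1⟩
    by_cases h : IsHeavyTriangle G x y z <;> simp [IsMildTriangle, h, this]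
  -- An edge gives weight 2 at codegree at most one and 1 at codegree two, hence at most 2 in total.
  -- A mild triangle receives 2, from one edge of the first kind or two of the second.
  have h1 := mul_card_triples_le (r := 2) (C := 2) (L := lightGraph G 2)
    (T := IsMildTriangle G)
    (w := fun x y => if codeg G x y ≤ 1 then 2 else if codeg G x y ≤ 2 then 1 else 0)
    (fun x y z h => ⟨⟨h.1.1.symm, h.1.2.2, h.1.2.1⟩, fun h' => h.2 h'.swap⟩)
    (fun x y z h => ⟨⟨h.1.2.1, h.1.1, h.1.2.2.symm⟩, fun h' => h.2 h'.swap_right⟩)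
    (by
      intro x y
      by_cases hxy : G.Adj x y
      · have hle : (univ.filter fun z => IsMildTriangle G x y z).card ≤ codeg G x y := by
          refine Finset.card_le_card fun z => ?_
          simp only [mem_filter, mem_univ, true_and]
          exact fun h => h.1.2
        have hadj : (lightGraph G 2).Adj x y ↔ codeg G x y ≤ 2 := by
          simp [lightGraph, hxy]
        simp only [hadj]
        split_ifs <;> omega
      · have : (univ.filter fun z => IsMildTriangle G x y z).card = 0 := by
          rw [Finset.card_eq_zero, Finset.filter_eq_empty_iff]
          exact fun z _ h => hxy h.1.1
        simp [this])
    (by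
      rintro x y z ⟨⟨k1, k2, k3⟩, h⟩
      have : ¬ (2 ≤ codeg G x y ∧ 2 ≤ codeg G x z ∧ 2 ≤ codeg G y z ∧
        (3 ≤ codeg G x y ∨ 3 ≤ codeg G x z) ∧ (3 ≤ codeg G x y ∨ 3 ≤ codeg G y z) ∧
        (3 ≤ codeg G x z ∨ 3 ≤ codeg G y z)) := fun h' => h ⟨k1, k2, k3, h'⟩
      split_ifs <;> omega)
  -- The same weights with heavy codegree. At least two edges of a heavy triangle have codegree
  -- three or more. If one of them has heavy codegree above two, another has heavy codegree one and
  -- pays 2; otherwise each pays at least 1.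
  have h2 := mul_card_triples_le (r := 2) (C := 2) (L := sparseHeavyGraph G)
    (T := IsHeavyTriangle G)
    (w := fun x y => if 3 ≤ codeg G x y then
      (if heavyCodeg G x y ≤ 1 then 2 else if heavyCodeg G x y ≤ 2 then 1 else 0) else 0)
    (fun x y z h => h.swap) (fun x y z h => h.swap_right)
    (by
      intro x y
      change _ * heavyCodeg G x y ≤ _
      by_cases hxy : G.Adj x y
      · have hadj : (sparseHeavyGraph G).Adj x y ↔
            3 ≤ codeg G x y ∧ heavyCodeg G x y ≤ 2 := by
          simp [sparseHeavyGraph, hxy]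
        simp only [hadj]
        split_ifs <;> omega
      · have : heavyCodeg G x y = 0 := by
          rw [heavyCodeg, Finset.card_eq_zero, Finset.filter_eq_empty_iff]
          exact fun z _ h => hxy h.1
        simp [this])
    (by
      intro x y z h
      have a1 := fun a b => h.heavyCodeg_le hG hA a b
      have a2 := fun a b => h.swap_right.heavyCodeg_le hG hA a b
      have a3 := fun a b => h.swap.heavyCodeg_le hG hA a b
      have a4 := fun a b => h.swap.swap_right.heavyCodeg_le hG hA a b
      have a5 := fun a b => h.swap_right.swap.heavyCodeg_le hG hA a b
      have a6 := fun a b => h.swap_right.swap.swap_right.heavyCodeg_le hG hA a b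
      rw [codeg_comm y x] at *
      rw [codeg_comm z x] at *
      rw [codeg_comm z y] at *
      rw [heavyCodeg_comm y x] at *
      rw [heavyCodeg_comm z x] at *
      rw [heavyCodeg_comm z y] at *
      obtain ⟨-, -, -, -, -, -, k1, k2, k3⟩ := h
      split_ifs <;> omega)
  have h3 := two_mul_adjPairs_sup_le (G := G)
  rw [adjPairs_sup_eq] at h3
  rw [hsplit]
  omega

lemma HasLightApexes.of_three_le_card (hG : LocallyPathFree G 6) {κ : Fin 4 → V} {W : Finset V}
    (hκ : ∀ i j, i ≠ j → G.Adj (κ i) (κ j)) (hW : ∀ i, κ i ∉ W)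
    (h : 3 ≤ (threeAttached G W (κ 0) (κ 1) (κ 2) (κ 3)).card) :
    ∃ m, ∀ i, i ≠ m → codeg G (κ m) (κ i) ≤ 2 := by
  obtain ⟨u, v, w, hu, hv, hw, huv, huw, hvw⟩ := Finset.two_lt_card_iff.1 h
  have hmem : ∀ x ∈ threeAttached G W (κ 0) (κ 1) (κ 2) (κ 3),
      x ∈ W ∧ ∃ m, ∀ i, i ≠ m → G.Adj (κ i) x := by
    intro x hx
    simp only [threeAttached, mem_filter] at hx
    refine ⟨hx.1, ?_⟩
    rcases hx.2 with h | h | h | h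
    · exact ⟨3, by simp [Fin.forall_fin_succ, h]⟩
    · exact ⟨2, by simp [Fin.forall_fin_succ, h]⟩
    · exact ⟨1, by simp [Fin.forall_fin_succ, h]⟩
    · exact ⟨0, by simp [Fin.forall_fin_succ, h]⟩
  have hall : ∀ s : Fin 3, (![u, v, w] : Fin 3 → V) s ∈
      threeAttached G W (κ 0) (κ 1) (κ 2) (κ 3) := by
    intro s; fin_cases s
    exacts [hu, hv, hw]
  refine exists_light_apex hG hκ (u := ![u, v, w]) ?_ ?_ fun s => (hmem _ (hall s)).2
  · intro s t hst
    fin_cases s <;> fin_cases t <;> simp_all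
  · intro s i hsi
    exact hW i (hsi ▸ (hmem _ (hall s)).1)

/-- The bound on ordered triangles for graphs whose neighbourhoods have no path with five edges. -/
theorem two_mul_triTriples_le_of_pathFree_six (n : ℕ) :
    ∀ {V : Type} [Fintype V] {G : SimpleGraph V}, Fintype.card V = n → LocallyPathFree G 6 →
      2 * triTriples G univ ≤ 3 * n ^ 2 + 60 * n := by
  induction n using Nat.strong_induction_on with
  | _ n ih =>
  intro V _ G hn hG
  by_cases hA : HasLightApexes G
  · have := two_mul_triTriples_le_of_hasLightApexes hG hA
    rw [hn] at this
    omega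
  · simp only [HasLightApexes, not_forall] at hA
    obtain ⟨κ, hκ, hlight⟩ := hA
    have h01 := hκ 0 1 (by decide)
    have h02 := hκ 0 2 (by decide)
    have h03 := hκ 0 3 (by decide)
    have h12 := hκ 1 2 (by decide)
    have h13 := hκ 1 3 (by decide)
    have h23 := hκ 2 3 (by decide)
    obtain ⟨W, w0, w1, w2, w3, hcard, huniv⟩ := exists_eq_insert_clique h01 h02 h03 h12 h13 h23
    have hle := triTriples_insert_clique_le_of_pathFree_six hG w0 w1 w2 w3 h01 h02 h03 h12 h13 h23
    have hX : (threeAttached G W (κ 0) (κ 1) (κ 2) (κ 3)).card ≤ 2 := by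
      by_contra! h3
      refine hlight (HasLightApexes.of_three_le_card hG hκ (fun i => ?_) h3)
      fin_cases i
      exacts [w0, w1, w2, w3]
    -- The induction ranges over all vertex types, so it applies to the subgraph induced on `W`. The
    -- deletion costs 24 |W| + 192 on the doubled scale, within the increase 24 |W| + 288 of the
    -- bound.
    have hrec := ih W.card (by omega) (Fintype.card_coe W) (hG.comap_val W)
    rw [triTriples_comap_val] at hrec
    rw [huniv] at hle
    have : n = W.card + 4 := by omega
    subst this
    nlinarith

/-- Second triangles on `zx` and `zy`, with apexes `a` and `b`, give the path a, x, y, b around `z`.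
It can degenerate only by a = b, which creates a K₄. -/
lemma exists_two_light_edges {x y z : V} (hG : LocallyPathFree G 4)
    (hK : ∀ a b c d, G.Adj a b → G.Adj a c → G.Adj a d → G.Adj b c → G.Adj b d → ¬ G.Adj c d)
    (hzx : G.Adj z x) (hzy : G.Adj z y) (hxy : G.Adj x y) (hx : 2 ≤ codeg G z x) :
    codeg G z y ≤ 1 := by
  by_contra! hy
  obtain ⟨a, ha, hza, hxa⟩ := exists_common_nbr {y} ((Finset.card_singleton y).trans_lt hx)
  obtain ⟨b, hb, hzb, hyb⟩ := exists_common_nbr {x} ((Finset.card_singleton x).trans_lt hy)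
  simp only [mem_singleton] at ha hb
  have := (hG z).four hza hzx hzy hzb hxa.symm hxy hyb
  have hab : a = b := by grind
  subst hab
  exact hK z x y a hzx hzy hza hxy hxa hyb

/-- Each triangle of the family has two edges of codegree one, and these are used by no other
triangle. The family `T` is arbitrary so that the bound serves all triangles when k = 3 and the thin
ones when k = 4. -/
lemma four_mul_card_triples_le (T : V → V → V → Prop)
    (hT : ∀ x y z, T x y z → G.Adj x y ∧ G.Adj x z ∧ G.Adj y z)
    (hT₁ : ∀ x y z, T x y z → T y x z) (hT₂ : ∀ x y z, T x y z → T x z y)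
    (hlight : ∀ x y z, T x y z → 2 ≤ codeg G z x → codeg G z y ≤ 1) :
    4 * (∑ x : V, ∑ y : V, ∑ z : V, if T x y z then 1 else 0) ≤
      3 * Fintype.card V ^ 2 + 12 * Fintype.card V := by
  have h1 := mul_card_triples_le (r := 2) (C := 1) (L := lightGraph G 1) (T := T)
    (w := fun x y => if codeg G x y ≤ 1 then 1 else 0) hT₁ hT₂
    (by
      intro x y
      by_cases hxy : G.Adj x y
      · have hle : (univ.filter fun z => T x y z).card ≤ codeg G x y := by
          refine Finset.card_le_card fun z => ?_
          simp only [mem_filter, mem_univ, true_and]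
          exact fun h => (hT x y z h).2
        have hadj : (lightGraph G 1).Adj x y ↔ codeg G x y ≤ 1 := by
          simp [lightGraph, hxy]
        simp only [hadj]
        split_ifs <;> omega
      · have : (univ.filter fun z => T x y z).card = 0 := by
          rw [Finset.card_eq_zero, Finset.filter_eq_empty_iff]
          exact fun z _ h => hxy (hT x y z h).1
        simp [this])
    (by
      intro x y z h
      have a1 := hlight x y z h
      have a2 := hlight x z y (hT₂ _ _ _ h)
      have a3 := hlight y z x (hT₂ _ _ _ (hT₁ _ _ _ h))
      rw [codeg_comm z x, codeg_comm z y] at *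
      rw [codeg_comm y x] at *
      split_ifs <;> omega)
  have h2 := two_mul_adjPairs_lightGraph_le (G := G) 1
  omega

/-- The bound on ordered triangles for graphs whose neighbourhoods have no path with three
edges. -/
theorem four_mul_triTriples_le_of_pathFree_four (n : ℕ) :
    ∀ {V : Type} [Fintype V] {G : SimpleGraph V}, Fintype.card V = n → LocallyPathFree G 4 →
      4 * triTriples G univ ≤ 3 * n ^ 2 + 60 * n := by
  induction n using Nat.strong_induction_on with
  | _ n ih =>
  intro V _ G hn hG
  by_cases hK : ∀ a b c d, G.Adj a b → G.Adj a c → G.Adj a d → G.Adj b c → G.Adj b d →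
      ¬ G.Adj c d
  · let T : V → V → V → Prop := fun x y z => G.Adj x y ∧ G.Adj x z ∧ G.Adj y z
    have := four_mul_card_triples_le (G := G) T
      (fun x y z h => h) (fun x y z h => ⟨h.1.symm, h.2.2, h.2.1⟩)
      (fun x y z h => ⟨h.2.1, h.1, h.2.2.symm⟩)
      (fun x y z h => exists_two_light_edges hG hK h.2.1.symm h.2.2.symm h.1)
    rw [hn] at this
    rw [triTriples_univ_eq (T := T) fun _ _ _ => Iff.rfl]
    omega
  · push Not at hK
    obtain ⟨a, b, c, d, hab, hac, had, hbc, hbd, hcd⟩ := hK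
    obtain ⟨W, wa, wb, wc, wd, hcard, huniv⟩ := exists_eq_insert_clique hab hac had hbc hbd hcd
    have hle := triTriples_insert_clique_le_of_pathFree_four hG wa wb wc wd hab hac had hbc hbd hcd
    have hrec := ih W.card (by omega) (Fintype.card_coe W) (hG.comap_val W)
    rw [triTriples_comap_val] at hrec
    rw [huniv] at hle
    have : n = W.card + 4 := by omega
    subst this
    nlinarith

end

end SuspendedPath

/-! ### Translation between suspensions, copies, cliques and ordered triples -/

namespace SuspendedPath

section

open Finset
open scoped Classical

variable {V : Type*} {G : SimpleGraph V}

lemma PathFreeOn.succ {k : ℕ} {s : Set V} (h : PathFreeOn G k s) : PathFreeOn G (k + 1) s := by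
  intro l h1 h2 h3 h4
  exact h l.tail h1.tail h2.tail (fun x hx => h3 x (List.mem_of_mem_tail hx)) (by simp [h4])

lemma LocallyPathFree.succ {k : ℕ} (h : LocallyPathFree G k) : LocallyPathFree G (k + 1) :=
  fun z => (h z).succ

lemma locallyPathFree_of_free {k : ℕ} (h : (suspension (pathWithEdges k)).Free G) :
    LocallyPathFree G (k + 1) := by
  intro z l h1 h2 h3 h4
  refine h ⟨⟨⟨fun o => o.elim z fun i => l.get (i.cast h4.symm), ?_⟩, ?_⟩⟩
  · have hstep : ∀ i j : Fin (k + 1), i.val + 1 = j.val →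
        G.Adj (l.get (i.cast h4.symm)) (l.get (j.cast h4.symm)) := by
      intro i j hij
      have := List.isChain_iff_getElem.1 h2 i.val (by omega)
      simpa [hij] using this
    rintro (_ | i) (_ | j) hij
    · exact hij.elim
    · exact h3 _ (List.get_mem _ _)
    · exact (h3 _ (List.get_mem _ _)).symm
    · rcases SimpleGraph.pathGraph_adj.1 hij with h | h
      · exact hstep i j h
      · exact (hstep j i h).symm
  · have hne : ∀ i : Fin (k + 1), z ≠ l.get (i.cast h4.symm) := fun i =>
      SimpleGraph.Adj.ne (h3 _ (List.get_mem _ _))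
    rintro (_ | i) (_ | j) hij
    · rfl
    · exact absurd hij (hne j)
    · exact absurd hij.symm (hne i)
    · have := h1.injective_get hij
      simpa [Fin.ext_iff] using this

lemma free_of_locallyPathFree {k : ℕ} (h : LocallyPathFree G (k + 1)) :
    (suspension (pathWithEdges k)).Free G := by
  rintro ⟨f⟩
  refine h (f none) (List.ofFn fun i => f (some i)) ?_ ?_ ?_ (by simp)
  · rw [List.nodup_ofFn]
    intro i j hij
    exact Option.some_injective _ (f.injective hij)
  · rw [List.isChain_iff_getElem]
    intro i hi
    simp only [List.getElem_ofFn]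
    refine f.toHom.map_adj ?_
    exact SimpleGraph.pathGraph_adj.2 (.inl rfl)
  · intro x hx
    obtain ⟨i, rfl⟩ := (List.mem_ofFn' _ _).1 hx
    exact f.toHom.map_adj (v := none) (w := some i) trivial

variable [Fintype V]

/-- A copy of the triangle is complete on its vertex set, hence determined by it. -/
lemma copyCount_triangleGraph_le : G.copyCount triangleGraph ≤ (G.cliqueFinset 3).card := by
  have hadj : ∀ G' : G.Subgraph, Nonempty (triangleGraph ≃g G'.coe) →
      ∀ u v, G'.Adj u v ↔ u ∈ G'.verts ∧ v ∈ G'.verts ∧ u ≠ v := by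
    rintro G' ⟨e⟩ u v
    refine ⟨fun h => ⟨G'.edge_vert h, G'.edge_vert h.symm, h.ne⟩, ?_⟩
    rintro ⟨hu, hv, huv⟩
    have : G'.coe.Adj ⟨u, hu⟩ ⟨v, hv⟩ := by
      rw [← e.symm.map_adj_iff]
      exact fun h => huv (congrArg Subtype.val (e.symm.injective h))
    exact this
  rw [SimpleGraph.copyCount]
  refine Finset.card_le_card_of_injOn (fun G' => G'.verts.toFinset) ?_ ?_
  · intro G' hG'
    have hG' : Nonempty (triangleGraph ≃g G'.coe) := by simpa using hG'
    obtain ⟨e⟩ := id hG'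
    simp only [mem_coe, SimpleGraph.mem_cliqueFinset_iff, SimpleGraph.isNClique_iff]
    constructor
    · intro u hu v hv huv
      exact ((hadj G' hG' u v).2 ⟨by simpa using hu, by simpa using hv, huv⟩).adj_sub
    · rw [Set.toFinset_card]
      simpa using (Fintype.card_congr e.toEquiv).symm
  · intro G₁ h₁ G₂ h₂ h
    have h₁ : Nonempty (triangleGraph ≃g G₁.coe) := by simpa using h₁
    have h₂ : Nonempty (triangleGraph ≃g G₂.coe) := by simpa using h₂
    have hv : G₁.verts = G₂.verts := by simpa using h
    ext u v
    · rw [hv]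
    · rw [hadj _ h₁, hadj _ h₂, hv]

lemma card_cliqueFinset_le_copyCount [DecidableEq V] [DecidableRel G.Adj] :
    (G.cliqueFinset 3).card ≤ G.copyCount triangleGraph := by
  rw [SimpleGraph.copyCount]
  refine Finset.card_le_card_of_injOn
    (fun s => (⊤ : G.Subgraph).induce (s : Set V)) ?_ ?_
  · intro s hs
    rw [mem_coe, SimpleGraph.mem_cliqueFinset_iff, SimpleGraph.isNClique_iff] at hs
    simp only [coe_filter, mem_univ, true_and, Set.mem_ofPred_eq]
    have e : Fin 3 ≃ ((⊤ : G.Subgraph).induce (s : Set V)).verts :=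
      Fintype.equivOfCardEq (by simp [hs.2])
    refine ⟨⟨e, ?_⟩⟩
    intro i j
    simp only [SimpleGraph.Subgraph.coe_adj, SimpleGraph.Subgraph.induce_adj,
      SimpleGraph.Subgraph.top_adj, SimpleGraph.top_adj]
    constructor
    · rintro ⟨-, -, h⟩ rfl
      exact G.irrefl h
    · intro h
      exact ⟨(e i).2, (e j).2, hs.1 (e i).2 (e j).2 fun h' => h (e.injective (Subtype.ext h'))⟩
  · intro s _ t _ h
    have := congrArg SimpleGraph.Subgraph.verts h
    simpa using this

lemma six_mul_card_cliqueFinset_le : 6 * (G.cliqueFinset 3).card ≤ triTriples G univ := by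
  set T := (univ : Finset (V × V × V)).filter fun p =>
    G.Adj p.1 p.2.1 ∧ G.Adj p.1 p.2.2 ∧ G.Adj p.2.1 p.2.2 with hT
  have hcard : triTriples G univ = T.card := by
    rw [hT, Finset.card_filter, triTriples, ← Finset.univ_product_univ, Finset.sum_product]
    refine Finset.sum_congr rfl fun x _ => ?_
    rw [← Finset.univ_product_univ, Finset.sum_product]
  rw [hcard, mul_comm]
  have hmaps : ∀ p ∈ T, ({p.1, p.2.1, p.2.2} : Finset V) ∈ G.cliqueFinset 3 := by
    intro p hp
    rw [SimpleGraph.mem_cliqueFinset_iff, SimpleGraph.is3Clique_triple_iff]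
    simpa [hT] using hp
  rw [Finset.card_eq_sum_card_fiberwise hmaps, ← smul_eq_mul]
  refine Finset.card_nsmul_le_sum _ _ _ fun s hs => ?_
  rw [SimpleGraph.mem_cliqueFinset_iff, SimpleGraph.is3Clique_iff] at hs
  obtain ⟨a, b, c, hab, hac, hbc, rfl⟩ := hs
  have h6 : ({(a, b, c), (a, c, b), (b, a, c), (b, c, a), (c, a, b), (c, b, a)} :
      Finset (V × V × V)).card = 6 := by
    have n1 := hab.ne
    have n2 := hac.ne
    have n3 := hbc.ne
    have n4 := hab.ne'
    have n5 := hac.ne'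
    have n6 := hbc.ne'
    simp [*]
  rw [← h6]
  refine Finset.card_le_card fun p hp => ?_
  simp only [mem_insert, mem_singleton] at hp
  have k1 := hab.symm
  have k2 := hac.symm
  have k3 := hbc.symm
  rcases hp with rfl | rfl | rfl | rfl | rfl | rfl <;>
    simp only [mem_filter, mem_univ, true_and, *, and_self] <;> ext x <;> simp <;> tauto

end

end SuspendedPath

/-! ### The case k = 4 by triangle removal -/

namespace SuspendedPath

section

open Finset
open scoped Classical

variable {V : Type*} [Fintype V] {G : SimpleGraph V}

lemma adjPairs_univ_eq (G : SimpleGraph V) [Fintype G.edgeSet] :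
    adjPairs G univ = 2 * G.edgeFinset.card := by
  have h := SimpleGraph.sum_degrees_eq_twice_card_edges G
  have h' : adjPairs G univ = ∑ x : V, G.degree x := by
    rw [adjPairs_eq_sum_card]
    refine Finset.sum_congr rfl fun x _ => ?_
    rw [← SimpleGraph.card_neighborFinset_eq_degree]
    congr 1
    ext y
    simp
  rw [h', h]
  congr! 2
  ext e
  simp

lemma adjPairs_sdiff_add {H : SimpleGraph V} (hHG : H ≤ G) :
    adjPairs (G \ H) univ + adjPairs H univ = adjPairs G univ := by
  simp only [adjPairs, ← Finset.sum_add_distrib]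
  refine Finset.sum_congr rfl fun x _ => Finset.sum_congr rfl fun y _ => ?_
  have := @hHG x y
  by_cases h1 : G.Adj x y <;> by_cases h2 : H.Adj x y <;> simp_all

lemma adjPairs_univ_le_sq (G : SimpleGraph V) : adjPairs G univ ≤ Fintype.card V ^ 2 := by
  rw [adjPairs_eq_card]
  refine (Finset.card_filter_le _ _).trans ?_
  rw [Finset.card_product, Finset.card_univ, sq]

/-- Three such pages, each with a further common neighbour e with `a`, plus a fourth page of `ab`,
yield a five-vertex path around `a`, where `b` is adjacent to every page. -/
lemma card_heavy_pages_le (hG : LocallyPathFree G 5) {a b : V} (hab : G.Adj a b)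
    (h : 5 ≤ codeg G a b) :
    (univ.filter fun c => G.Adj a c ∧ G.Adj b c ∧ 2 ≤ codeg G a c).card ≤ 2 := by
  by_contra! h3
  obtain ⟨c₁, c₂, c₃, h₁, h₂, h₃, n12, n13, n23⟩ := Finset.two_lt_card_iff.1 h3
  simp only [mem_filter, mem_univ, true_and] at h₁ h₂ h₃
  obtain ⟨ha1, hb1, k1⟩ := h₁
  obtain ⟨ha2, hb2, k2⟩ := h₂
  obtain ⟨ha3, hb3, k3⟩ := h₃
  obtain ⟨c₄, h4, ha4, hb4⟩ := exists_common_nbr {c₁, c₂, c₃}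
    (Finset.card_le_three.trans_lt (lt_of_lt_of_le (by norm_num) h))
  simp only [mem_insert, mem_singleton, not_or] at h4
  have hex : ∀ c, 2 ≤ codeg G a c → ∃ e, e ≠ b ∧ G.Adj a e ∧ G.Adj c e := by
    intro c hc
    obtain ⟨e, he, h⟩ := exists_common_nbr {b} ((Finset.card_singleton b).trans_lt hc)
    exact ⟨e, by simpa using he, h⟩
  -- The path e, r, b, p, q forces e to be `p` or `q`; then the edge `pq` followed by `r`, `b`, `c₄`
  -- is a path, up to the order of `p` and `q`.
  have hQ : ∀ p q r, G.Adj a p → G.Adj b p → G.Adj a q → G.Adj b q → G.Adj a r → G.Adj b r →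
      p ≠ q → p ≠ r → q ≠ r → c₄ ≠ p → c₄ ≠ q → c₄ ≠ r → 2 ≤ codeg G a r → ¬ G.Adj p q := by
    intro p q r hap hbp haq hbq har hbr hpq hpr hqr h4p h4q h4r hr hadj
    obtain ⟨e, heb, hae, hre⟩ := hex r hr
    have t1 := (hG a).five hae har hab hap haq hre.symm hbr.symm hbp hadj
    have n1 := hbp.ne
    have n2 := hbq.ne
    have n3 := hbr.ne
    have n4 := hb4.ne
    have he : e = p ∨ e = q := by grind
    rcases he with rfl | rfl
    · have := (hG a).five haq hap har hab ha4 hadj.symm hre.symm hbr.symm hb4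
      grind
    · have := (hG a).five hap haq har hab ha4 hadj hre.symm hbr.symm hb4
      grind
  have q12 := hQ c₁ c₂ c₃ ha1 hb1 ha2 hb2 ha3 hb3 n12 n13 n23 h4.1 h4.2.1 h4.2.2 k3
  have q13 := hQ c₁ c₃ c₂ ha1 hb1 ha3 hb3 ha2 hb2 n13 n12 n23.symm h4.1 h4.2.2 h4.2.1 k2
  have q23 := hQ c₂ c₃ c₁ ha2 hb2 ha3 hb3 ha1 hb1 n23 n12.symm n13.symm h4.2.1 h4.2.2 h4.1 k1
  obtain ⟨e₁, f1, g1, i1⟩ := hex c₁ k1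
  obtain ⟨e₂, f2, g2, i2⟩ := hex c₂ k2
  have m1 := hb1.ne
  have m2 := hb2.ne
  have e1c2 : e₁ ≠ c₂ := by rintro rfl; exact q12 i1
  have e2c1 : e₂ ≠ c₁ := by rintro rfl; exact q12 i2.symm
  have e1c3 : e₁ ≠ c₃ := by rintro rfl; exact q13 i1
  -- This path forces `e₁ = e₂`; the common vertex then gives the path c₁, e₁, c₂, b, c₃.
  have t := (hG a).five g1 ha1 hab ha2 g2 i1.symm hb1.symm hb2 i2
  have e12 : e₁ = e₂ := by grind
  subst e12
  have := (hG a).five ha1 g1 ha2 hab ha3 i1 i2.symm hb2.symm hb3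
  grind

/-- A triangle with at least two edges of codegree one. -/
def IsThinTriangle (G : SimpleGraph V) (x y z : V) : Prop :=
  (G.Adj x y ∧ G.Adj x z ∧ G.Adj y z) ∧ (codeg G x y ≤ 1 ∨ codeg G x z ≤ 1) ∧
    (codeg G x y ≤ 1 ∨ codeg G y z ≤ 1) ∧ (codeg G x z ≤ 1 ∨ codeg G y z ≤ 1)

/-- A triangle with at least two edges of codegree at least two. -/
def IsThickTriangle (G : SimpleGraph V) (x y z : V) : Prop :=
  (G.Adj x y ∧ G.Adj x z ∧ G.Adj y z) ∧ ¬ IsThinTriangle G x y z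

lemma IsThinTriangle.swap {x y z : V} (h : IsThinTriangle G x y z) : IsThinTriangle G y x z := by
  obtain ⟨⟨h1, h2, h3⟩, h4, h5, h6⟩ := h
  rw [codeg_comm x y] at *
  exact ⟨⟨h1.symm, h3, h2⟩, h5, h4, h6.symm⟩

lemma IsThinTriangle.swap_right {x y z : V} (h : IsThinTriangle G x y z) :
    IsThinTriangle G x z y := by
  obtain ⟨⟨h1, h2, h3⟩, h4, h5, h6⟩ := h
  rw [codeg_comm y z] at *
  exact ⟨⟨h2, h1, h3.symm⟩, h4.symm, h6, h5⟩

lemma IsThickTriangle.swap {x y z : V} (h : IsThickTriangle G x y z) : IsThickTriangle G y x z :=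
  ⟨⟨h.1.1.symm, h.1.2.2, h.1.2.1⟩, fun h' => h.2 h'.swap⟩

lemma IsThickTriangle.swap_right {x y z : V} (h : IsThickTriangle G x y z) :
    IsThickTriangle G x z y :=
  ⟨⟨h.1.2.1, h.1.1, h.1.2.2.symm⟩, fun h' => h.2 h'.swap_right⟩

lemma triTriples_eq_thin_add_thick :
    triTriples G univ = (∑ x : V, ∑ y : V, ∑ z : V, if IsThinTriangle G x y z then 1 else 0) +
      ∑ x : V, ∑ y : V, ∑ z : V, if IsThickTriangle G x y z then 1 else 0 := by
  simp only [triTriples, ← Finset.sum_add_distrib]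
  refine Finset.sum_congr rfl fun x _ => Finset.sum_congr rfl fun y _ =>
    Finset.sum_congr rfl fun z _ => ?_
  have : IsThinTriangle G x y z → G.Adj x y ∧ G.Adj x z ∧ G.Adj y z := fun h => h.1
  by_cases h : IsThinTriangle G x y z <;> simp [IsThickTriangle, h, this]

lemma four_mul_thin_le :
    4 * (∑ x : V, ∑ y : V, ∑ z : V, if IsThinTriangle G x y z then 1 else 0) ≤
      3 * Fintype.card V ^ 2 + 12 * Fintype.card V := by
  refine four_mul_card_triples_le (G := G) _ (fun x y z h => h.1) (fun x y z h => h.swap)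
    (fun x y z h => h.swap_right) ?_
  rintro x y z ⟨-, -, -, h⟩ hx
  rw [codeg_comm z x] at hx
  rw [codeg_comm z y]
  omega

/-- For codegree at least five, a thick triangle on `ab` has another edge of codegree at least two,
at `a` or at `b`, and each end allows at most two such apexes. -/
lemma card_thick_le (hG : LocallyPathFree G 5) (a b : V) :
    (univ.filter fun c => IsThickTriangle G a b c).card ≤ 4 := by
  by_cases hab : G.Adj a b
  · by_cases h : codeg G a b ≤ 4
    · refine le_trans (Finset.card_le_card fun c => ?_) h
      simp only [mem_filter, mem_univ, true_and]
      exact fun h => h.1.2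
    · have h1 := card_heavy_pages_le hG hab (by omega)
      have h2 := card_heavy_pages_le hG hab.symm (by rw [codeg_comm]; omega)
      refine le_trans (Finset.card_le_card fun c hc => ?_)
        ((Finset.card_union_le _ _).trans (add_le_add h1 h2))
      simp only [mem_filter, mem_univ, true_and, mem_union] at hc ⊢
      obtain ⟨⟨-, hac, hbc⟩, hthin⟩ := hc
      by_cases h1 : 2 ≤ codeg G a c
      · exact .inl ⟨hac, hbc, h1⟩
      by_cases h2 : 2 ≤ codeg G b c
      · exact .inr ⟨hbc, hac, h2⟩
      exact absurd ⟨⟨hab, hac, hbc⟩, .inr (by omega), .inr (by omega), .inr (by omega)⟩ hthin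
  · rw [Finset.filter_eq_empty_iff.2 fun c _ h => hab h.1.1]
    simp

/-- Deleting edges that meet all triangles bounds the number of thick triangles. -/
lemma thick_le_of_cliqueFree (hG : LocallyPathFree G 5) {H : SimpleGraph V}
    (hH : H.CliqueFree 3) :
    (∑ x : V, ∑ y : V, ∑ z : V, if IsThickTriangle G x y z then 1 else 0) ≤
      12 * adjPairs (G \ H) univ := by
  have := mul_card_triples_le (r := 1) (C := 4) (L := G \ H) (T := IsThickTriangle G)
    (w := fun x y => if (G \ H).Adj x y then 1 else 0) (fun x y z h => h.swap)
    (fun x y z h => h.swap_right)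
    (by
      intro x y
      have := card_thick_le hG x y
      split_ifs <;> omega)
    (by
      rintro x y z ⟨⟨h1, h2, h3⟩, -⟩
      have : ¬ (H.Adj x y ∧ H.Adj x z ∧ H.Adj y z) := fun h =>
        hH {x, y, z} (SimpleGraph.is3Clique_triple_iff.2 h)
      simp only [SimpleGraph.sdiff_adj, h1, h2, h3, true_and]
      by_cases k1 : H.Adj x y <;> by_cases k2 : H.Adj x z <;> by_cases k3 : H.Adj y z <;>
        simp_all)
  omega

/-- A crude bound from deleting every edge; being o(n³), it is what makes triangle removal
applicable. -/
lemma card_cliqueFinset_le_sq (hG : LocallyPathFree G 5) :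
    (G.cliqueFinset 3).card ≤ 10 * Fintype.card V ^ 2 := by
  have h1 := six_mul_card_cliqueFinset_le (G := G)
  have h2 := thick_le_of_cliqueFree hG (H := ⊥) (SimpleGraph.cliqueFree_bot (by norm_num))
  have h3 := four_mul_thin_le (G := G)
  have h4 := adjPairs_univ_le_sq (G \ ⊥)
  have h5 : Fintype.card V ≤ Fintype.card V ^ 2 := Nat.le_self_pow (by norm_num) _
  rw [triTriples_eq_thin_add_thick] at h1
  omega

lemma card_cliqueFinset_le_of_pathFree_five (hG : LocallyPathFree G 5) {ε : ℝ} (hε : 0 < ε)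
    (hV : 10 / SimpleGraph.triangleRemovalBound ε < Fintype.card V) :
    ((G.cliqueFinset 3).card : ℝ) ≤
      (Fintype.card V : ℝ) ^ 2 / 8 + Fintype.card V / 2 + 4 * ε * (Fintype.card V : ℝ) ^ 2 := by
  set n := Fintype.card V with hn
  have hδ := SimpleGraph.triangleRemovalBound_pos hε
  have hn0 : (0 : ℝ) < n := lt_trans (by positivity) hV
  have hlt : ((G.cliqueFinset 3).card : ℝ) < SimpleGraph.triangleRemovalBound ε * n ^ 3 := by
    have h1 : ((G.cliqueFinset 3).card : ℝ) ≤ 10 * (n : ℝ) ^ 2 := by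
      exact_mod_cast card_cliqueFinset_le_sq hG
    rw [div_lt_iff₀ hδ] at hV
    nlinarith [pow_pos hn0 2]
  obtain ⟨H, hHG, _, hcard, hfree⟩ := SimpleGraph.triangle_removal hlt
  have h1 := six_mul_card_cliqueFinset_le (G := G)
  have h2 := thick_le_of_cliqueFree hG hfree
  have h3 := four_mul_thin_le (G := G)
  rw [triTriples_eq_thin_add_thick] at h1
  generalize (∑ x : V, ∑ y : V, ∑ z : V, if IsThickTriangle G x y z then 1 else 0) = b at h1 h2
  generalize (∑ x : V, ∑ y : V, ∑ z : V, if IsThinTriangle G x y z then 1 else 0) = a at h1 h3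
  have h4 := adjPairs_sdiff_add hHG
  rw [adjPairs_univ_eq G, adjPairs_univ_eq H] at h4
  have h1' : (6 : ℝ) * (G.cliqueFinset 3).card ≤ a + b := by exact_mod_cast h1
  have h2' : (b : ℝ) ≤ 12 * adjPairs (G \ H) univ := by exact_mod_cast h2
  have h3' : 4 * (a : ℝ) ≤ 3 * (n : ℝ) ^ 2 + 12 * n := by exact_mod_cast h3
  have h4' : (adjPairs (G \ H) univ : ℝ) + 2 * H.edgeFinset.card = 2 * G.edgeFinset.card := by
    exact_mod_cast h4
  push_cast at hcard
  linarith

end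

end SuspendedPath

/-! ### Extremal constructions and asymptotics -/

namespace SuspendedPath

open Finset
open scoped Classical

/-- Disjoint cliques of size `r` on the first `r * m` vertices, all of them joined to an independent
set on the remaining vertices. -/
def cliquesJoinIndep (n m r : ℕ) : SimpleGraph (Fin n) where
  Adj v w := v ≠ w ∧ ((v.val < r * m ∧ r * m ≤ w.val) ∨ (w.val < r * m ∧ r * m ≤ v.val) ∨
    (v.val < r * m ∧ w.val < r * m ∧ v.val / r = w.val / r))
  symm := ⟨fun v w h => ⟨h.1.symm, by tauto⟩⟩
  loopless := ⟨fun _ h => h.1 rfl⟩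

lemma locallyPathFree_cliquesJoinIndep_two (n m : ℕ) :
    LocallyPathFree (cliquesJoinIndep n m 2) 4 := by
  intro z l h1 h2 h3 h4
  match l, h4 with
  | [a, b, c, d], _ =>
    simp only [List.nodup_cons, List.mem_cons, List.not_mem_nil, or_false, not_or, Fin.ext_iff,
      List.isChain_cons_cons, cliquesJoinIndep, ne_eq] at h1 h2
    obtain ⟨⟨-, hac, had⟩, ⟨-, hbd⟩, -⟩ := h1
    obtain ⟨hab, hbc, hcd, -⟩ := h2
    have ha := h3 a (by simp)
    have hb := h3 b (by simp)
    have hc := h3 c (by simp)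
    have hd := h3 d (by simp)
    simp only [cliquesJoinIndep, Set.mem_ofPred_eq, ne_eq, Fin.ext_iff] at ha hb hc hd
    by_cases hz : z.val < 2 * m
    -- Every edge in the neighbourhood of a clique-side vertex contains a mate from its own block.
    -- There is only one mate, so the disjoint edges `ab` and `cd` cannot both exist.
    · have key : ∀ x y : ℕ, ((z.val < 2 * m ∧ 2 * m ≤ x) ∨ (x < 2 * m ∧ 2 * m ≤ z.val) ∨
          (z.val < 2 * m ∧ x < 2 * m ∧ z.val / 2 = x / 2)) →
          ((z.val < 2 * m ∧ 2 * m ≤ y) ∨ (y < 2 * m ∧ 2 * m ≤ z.val) ∨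
          (z.val < 2 * m ∧ y < 2 * m ∧ z.val / 2 = y / 2)) →
          ((x < 2 * m ∧ 2 * m ≤ y) ∨ (y < 2 * m ∧ 2 * m ≤ x) ∨
          (x < 2 * m ∧ y < 2 * m ∧ x / 2 = y / 2)) → z.val / 2 = x / 2 ∨ z.val / 2 = y / 2 := by
        intro x y; omega
      have e1 := key _ _ ha.2 hb.2 hab.2
      have e2 := key _ _ hc.2 hd.2 hcd.2
      replace ha := ha.1
      replace hb := hb.1
      replace hc := hc.1
      replace hd := hd.1
      clear hab hcd key
      omega
    · have ha' : a.val < 2 * m := by omega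
      have hb' : b.val < 2 * m := by omega
      have hc' : c.val < 2 * m := by omega
      have e1 : a.val / 2 = b.val / 2 := by omega
      have e2 : b.val / 2 = c.val / 2 := by omega
      omega

lemma locallyPathFree_cliquesJoinIndep_three (n m : ℕ) :
    LocallyPathFree (cliquesJoinIndep n m 3) 6 := by
  intro z l h1 h2 h3 h4
  match l, h4 with
  | [a, b, c, d, e, f], _ =>
    simp only [List.nodup_cons, List.mem_cons, List.not_mem_nil, or_false, not_or, Fin.ext_iff,
      List.isChain_cons_cons, cliquesJoinIndep, ne_eq] at h1 h2
    obtain ⟨⟨n1, n2, n3, n4, n5⟩, ⟨n6, n7, n8, n9⟩, ⟨n10, n11, n12⟩, ⟨n13, n14⟩, n15, -⟩ := h1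
    obtain ⟨hab, hbc, hcd, hde, hef, -⟩ := h2
    have ha := h3 a (by simp)
    have hb := h3 b (by simp)
    have hc := h3 c (by simp)
    have hd := h3 d (by simp)
    have he := h3 e (by simp)
    have hf := h3 f (by simp)
    simp only [cliquesJoinIndep, Set.mem_ofPred_eq, ne_eq, Fin.ext_iff] at ha hb hc hd he hf
    by_cases hz : z.val < 3 * m
    -- Likewise the disjoint edges `ab`, `cd`, `ef` would need three distinct block mates, but a
    -- block offers two.
    · have key : ∀ x y : ℕ, ((z.val < 3 * m ∧ 3 * m ≤ x) ∨ (x < 3 * m ∧ 3 * m ≤ z.val) ∨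
          (z.val < 3 * m ∧ x < 3 * m ∧ z.val / 3 = x / 3)) →
          ((z.val < 3 * m ∧ 3 * m ≤ y) ∨ (y < 3 * m ∧ 3 * m ≤ z.val) ∨
          (z.val < 3 * m ∧ y < 3 * m ∧ z.val / 3 = y / 3)) →
          ((x < 3 * m ∧ 3 * m ≤ y) ∨ (y < 3 * m ∧ 3 * m ≤ x) ∨
          (x < 3 * m ∧ y < 3 * m ∧ x / 3 = y / 3)) → z.val / 3 = x / 3 ∨ z.val / 3 = y / 3 := by
        intro x y; omega
      have e1 := key _ _ ha.2 hb.2 hab.2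
      have e2 := key _ _ hc.2 hd.2 hcd.2
      have e3 := key _ _ he.2 hf.2 hef.2
      replace ha := ha.1
      replace hb := hb.1
      replace hc := hc.1
      replace hd := hd.1
      replace he := he.1
      replace hf := hf.1
      have three : ∀ x y w : ℕ, z.val / 3 = x / 3 → z.val / 3 = y / 3 → z.val / 3 = w / 3 →
          ¬ z.val = x → ¬ z.val = y → ¬ z.val = w → ¬ x = y → ¬ x = w → ¬ y = w → False := by
        intro x y w; omega
      rcases e1 with e1 | e1 <;> rcases e2 with e2 | e2 <;> rcases e3 with e3 | e3 <;>
        exact three _ _ _ e1 e2 e3 (by assumption) (by assumption) (by assumption)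
          (by assumption) (by assumption) (by assumption)
    · have hB : ∀ x : ℕ, ((z.val < 3 * m ∧ 3 * m ≤ x) ∨ (x < 3 * m ∧ 3 * m ≤ z.val) ∨
          (z.val < 3 * m ∧ x < 3 * m ∧ z.val / 3 = x / 3)) → x < 3 * m := by
        intro x; omega
      have hA : ∀ x y : ℕ, x < 3 * m → y < 3 * m → ((x < 3 * m ∧ 3 * m ≤ y) ∨
          (y < 3 * m ∧ 3 * m ≤ x) ∨ (x < 3 * m ∧ y < 3 * m ∧ x / 3 = y / 3)) →
          x / 3 = y / 3 := by
        intro x y; omega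
      have four : ∀ x y w v : ℕ, x / 3 = y / 3 → y / 3 = w / 3 → w / 3 = v / 3 → ¬ x = y →
          ¬ x = w → ¬ x = v → ¬ y = w → ¬ y = v → ¬ w = v → False := by
        intro x y w v; omega
      have ha' := hB _ ha.2
      have hb' := hB _ hb.2
      have hc' := hB _ hc.2
      have hd' := hB _ hd.2
      exact four _ _ _ _ (hA _ _ ha' hb' hab.2) (hA _ _ hb' hc' hbc.2) (hA _ _ hc' hd' hcd.2)
        n1 n2 n3 n6 n7 n10

lemma le_card_cliqueFinset_two {n m : ℕ} (h : 2 * m ≤ n) :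
    m * (n - 2 * m) ≤ ((cliquesJoinIndep n m 2).cliqueFinset 3).card := by
  have hcard : m * (n - 2 * m) = (univ : Finset (Fin m × Fin (n - 2 * m))).card := by simp
  rw [hcard]
  refine Finset.card_le_card_of_injOn (fun p =>
    {⟨2 * p.1.val, by omega⟩, ⟨2 * p.1.val + 1, by omega⟩, ⟨2 * m + p.2.val, by omega⟩}) ?_ ?_
  · rintro ⟨i, j⟩ -
    rw [mem_coe, SimpleGraph.mem_cliqueFinset_iff, SimpleGraph.is3Clique_triple_iff]
    simp only [cliquesJoinIndep, ne_eq, Fin.ext_iff]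
    have := i.2
    refine ⟨⟨?_, ?_⟩, ⟨?_, ?_⟩, ⟨?_, ?_⟩⟩ <;> omega
  · rintro ⟨i, j⟩ - ⟨i', j'⟩ - hij
    have h1 := Finset.ext_iff.1 hij ⟨2 * i.val, by omega⟩
    have h2 := Finset.ext_iff.1 hij ⟨2 * m + j.val, by omega⟩
    simp only [mem_insert, mem_singleton, Fin.ext_iff, true_or, or_true, true_iff] at h1 h2
    have := i.2
    have := i'.2
    exact Prod.ext (Fin.ext (by dsimp only; omega)) (Fin.ext (by dsimp only; omega))

lemma le_card_cliqueFinset_three {n m : ℕ} (h : 3 * m ≤ n) :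
    3 * m * (n - 3 * m) ≤ ((cliquesJoinIndep n m 3).cliqueFinset 3).card := by
  have hcard : 3 * m * (n - 3 * m) = (univ : Finset (Fin (3 * m) × Fin (n - 3 * m))).card := by
    simp
  rw [hcard]
  -- Cyclic successor within a block: the pairs {i, σ i} list each block edge once, because a
  -- 3-cycle never swaps two points.
  let σ : ℕ → ℕ := fun i => if i % 3 = 2 then i - 2 else i + 1
  have hσ : ∀ i, i < 3 * m → σ i < 3 * m := by
    intro i hi; simp only [σ]; split_ifs <;> omega
  refine Finset.card_le_card_of_injOn (fun p =>
    {⟨p.1.val, by omega⟩, ⟨σ p.1.val, (hσ _ p.1.2).trans_le h⟩, ⟨3 * m + p.2.val, by omega⟩}) ?_ ?_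
  · rintro ⟨i, j⟩ -
    rw [mem_coe, SimpleGraph.mem_cliqueFinset_iff, SimpleGraph.is3Clique_triple_iff]
    simp only [cliquesJoinIndep, ne_eq, Fin.ext_iff]
    have := i.2
    have := hσ i i.2
    refine ⟨⟨?_, ?_⟩, ⟨?_, ?_⟩, ⟨?_, ?_⟩⟩ <;> simp only [σ] at * <;> split_ifs at * <;> omega
  · rintro ⟨i, j⟩ - ⟨i', j'⟩ - hij
    have h1 := Finset.ext_iff.1 hij ⟨i.val, by omega⟩
    have h2 := Finset.ext_iff.1 hij ⟨σ i.val, (hσ _ i.2).trans_le h⟩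
    have h3 := Finset.ext_iff.1 hij ⟨3 * m + j.val, by omega⟩
    simp only [mem_insert, mem_singleton, Fin.ext_iff, true_or, or_true, true_iff] at h1 h2 h3
    have := i.2
    have := i'.2
    have := hσ i i.2
    have := hσ i' i'.2
    have e1 : i.val = i'.val ∨ i.val = σ i' := by omega
    have e2 : σ i.val = i'.val ∨ σ i.val = σ i' := by omega
    have e3 : j.val = j'.val := by omega
    have e4 : i.val = i'.val := by
      clear h1 h2 h3
      simp only [σ] at *
      split_ifs at * <;> omega
    exact Prod.ext (Fin.ext e4) (Fin.ext e3)

lemma copyCount_le_of_pathFree_four {n : ℕ} {G : SimpleGraph (Fin n)} (h : LocallyPathFree G 4) :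
    (G.copyCount triangleGraph : ℝ) ≤ (n : ℝ) ^ 2 / 8 + 5 / 2 * n := by
  have h1 := copyCount_triangleGraph_le (G := G)
  have h2 := six_mul_card_cliqueFinset_le (G := G)
  have h3 := four_mul_triTriples_le_of_pathFree_four n (by simp) h
  have h4 : 24 * G.copyCount triangleGraph ≤ 3 * n ^ 2 + 60 * n := by omega
  have h5 : (24 : ℝ) * G.copyCount triangleGraph ≤ 3 * (n : ℝ) ^ 2 + 60 * n := by exact_mod_cast h4
  linarith

lemma copyCount_le_of_pathFree_six {n : ℕ} {G : SimpleGraph (Fin n)} (h : LocallyPathFree G 6) :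
    (G.copyCount triangleGraph : ℝ) ≤ (n : ℝ) ^ 2 / 4 + 5 * n := by
  have h1 := copyCount_triangleGraph_le (G := G)
  have h2 := six_mul_card_cliqueFinset_le (G := G)
  have h3 := two_mul_triTriples_le_of_pathFree_six n (by simp) h
  have h4 : 12 * G.copyCount triangleGraph ≤ 3 * n ^ 2 + 60 * n := by omega
  have h5 : (12 : ℝ) * G.copyCount triangleGraph ≤ 3 * (n : ℝ) ^ 2 + 60 * n := by exact_mod_cast h4
  linarith

lemma genTuran_le {n k : ℕ} {B : ℝ} (hB : 0 ≤ B)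
    (h : ∀ G : SimpleGraph (Fin n), LocallyPathFree G (k + 1) →
      (G.copyCount triangleGraph : ℝ) ≤ B) :
    (genTuran n triangleGraph (suspension (pathWithEdges k)) : ℝ) ≤ B := by
  rw [← Nat.le_floor_iff hB]
  refine Finset.sup_le fun G hG => Nat.le_floor ?_
  exact h G (locallyPathFree_of_free (by simpa using hG))

lemma card_cliqueFinset_le_genTuran {n k : ℕ} {G : SimpleGraph (Fin n)}
    (h : LocallyPathFree G (k + 1)) :
    (G.cliqueFinset 3).card ≤ genTuran n triangleGraph (suspension (pathWithEdges k)) := by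
  refine card_cliqueFinset_le_copyCount.trans ?_
  exact Finset.le_sup (f := fun G : SimpleGraph (Fin n) => G.copyCount triangleGraph)
    (by simpa using free_of_locallyPathFree h)

/-- One construction serves both k = 3 and k = 4; taking `m = n / 4` puts about half of the vertices
into the matching. -/
lemma le_genTuran_of_pathFree_four {n k : ℕ}
    (h : ∀ G : SimpleGraph (Fin n), LocallyPathFree G 4 → LocallyPathFree G (k + 1)) :
    (n : ℝ) ^ 2 / 8 - n ≤ genTuran n triangleGraph (suspension (pathWithEdges k)) := by
  have h1 := (le_card_cliqueFinset_two (n := n) (m := n / 4) (by omega)).trans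
    (card_cliqueFinset_le_genTuran (h _ (locallyPathFree_cliquesJoinIndep_two n (n / 4))))
  refine le_trans ?_ (Nat.cast_le.2 h1)
  obtain ⟨q, s, hs, hn⟩ : ∃ q s, s < 4 ∧ n = 4 * q + s := ⟨n / 4, n % 4, by omega, by omega⟩
  have e1 : n / 4 = q := by omega
  have e2 : n - 2 * q = 2 * q + s := by omega
  rw [e1, e2, hn]
  push_cast
  have : (s : ℝ) ≤ 3 := by exact_mod_cast Nat.le_of_lt_succ hs
  nlinarith [Nat.cast_nonneg (α := ℝ) q, Nat.cast_nonneg (α := ℝ) s]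

lemma le_genTuran_five (n : ℕ) :
    (n : ℝ) ^ 2 / 4 - 2 * n ≤ genTuran n triangleGraph (suspension (pathWithEdges 5)) := by
  have h1 := (le_card_cliqueFinset_three (n := n) (m := n / 6) (by omega)).trans
    (card_cliqueFinset_le_genTuran (k := 5) (locallyPathFree_cliquesJoinIndep_three n (n / 6)))
  refine le_trans ?_ (Nat.cast_le.2 h1)
  obtain ⟨q, s, hs, hn⟩ : ∃ q s, s < 6 ∧ n = 6 * q + s := ⟨n / 6, n % 6, by omega, by omega⟩
  have e1 : n / 6 = q := by omega
  have e2 : n - 3 * q = 3 * q + s := by omega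
  rw [e1, e2, hn]
  push_cast
  have : (s : ℝ) ≤ 5 := by exact_mod_cast Nat.le_of_lt_succ hs
  nlinarith [Nat.cast_nonneg (α := ℝ) q, Nat.cast_nonneg (α := ℝ) s]

lemma genTuran_sub_isBigO {k : ℕ} (hk : k = 3 ∨ k = 5) :
    (fun n : ℕ => (genTuran n triangleGraph (suspension (pathWithEdges k)) : ℝ)
        - (((k - 1) / 2 : ℕ) : ℝ) * ((n : ℝ) ^ 2 / 8)) =O[atTop] fun n : ℕ => (n : ℝ) := by
  refine IsBigO.of_bound 5 (Eventually.of_forall fun n => ?_)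
  rw [Real.norm_eq_abs, Real.norm_eq_abs, Nat.abs_cast, abs_le]
  have hn : (0 : ℝ) ≤ n := Nat.cast_nonneg n
  rcases hk with rfl | rfl
  · have h1 := le_genTuran_of_pathFree_four (n := n) (k := 3) fun _ h => h
    have h2 := genTuran_le (n := n) (k := 3) (by positivity) fun G h =>
      copyCount_le_of_pathFree_four h
    norm_num
    constructor <;> linarith
  · have h1 := le_genTuran_five n
    have h2 := genTuran_le (n := n) (k := 5) (by positivity) fun G h =>
      copyCount_le_of_pathFree_six h
    norm_num
    constructor <;> linarith

lemma natCast_isLittleO_sq : (fun n : ℕ => (n : ℝ)) =o[atTop] fun n : ℕ => (n : ℝ) ^ 2 := by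
  have := (isLittleO_pow_pow_atTop_of_lt (𝕜 := ℝ) (show 1 < 2 by norm_num)).comp_tendsto
    tendsto_natCast_atTop_atTop
  simpa [Function.comp_def] using this

lemma genTuran_four_sub_isLittleO :
    (fun n : ℕ => (genTuran n triangleGraph (suspension (pathWithEdges 4)) : ℝ)
        - (((4 - 1) / 2 : ℕ) : ℝ) * ((n : ℝ) ^ 2 / 8)) =o[atTop] fun n : ℕ => (n : ℝ) ^ 2 := by
  rw [isLittleO_iff]
  intro c hc
  -- With ε = c / 8 the removal error is c n² / 2, leaving room for the linear terms.
  have hε : 0 < c / 8 := by positivity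
  have hlarge := tendsto_natCast_atTop_atTop (R := ℝ) |>.eventually_gt_atTop
    (10 / SimpleGraph.triangleRemovalBound (c / 8))
  filter_upwards [hlarge, natCast_isLittleO_sq.bound (show 0 < c / 2 by positivity)] with n h h'
  rw [Real.norm_eq_abs, Real.norm_eq_abs, Nat.abs_cast, abs_of_nonneg (by positivity)] at h'
  rw [Real.norm_eq_abs, Real.norm_eq_abs, abs_of_nonneg (by positivity : (0 : ℝ) ≤ (n : ℝ) ^ 2),
    abs_le]
  have hn : (0 : ℝ) ≤ n := Nat.cast_nonneg n
  have hcn : 0 ≤ c * (n : ℝ) ^ 2 := by positivity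
  have h1 := le_genTuran_of_pathFree_four (n := n) (k := 4) fun _ h => h.succ
  have h2 := genTuran_le (n := n) (k := 4)
    (B := (n : ℝ) ^ 2 / 8 + n / 2 + 4 * (c / 8) * (n : ℝ) ^ 2) (by positivity) (by
      intro G hG
      have := card_cliqueFinset_le_of_pathFree_five hG hε (by simpa using h)
      rw [Fintype.card_fin] at this
      exact (Nat.cast_le.2 copyCount_triangleGraph_le).trans this)
  norm_num
  constructor <;> linarith

end SuspendedPath

theorem theorem4 :
    (∀ k ∈ ({3, 4, 5} : Set ℕ),
      (fun n : ℕ => (genTuran n triangleGraph (suspension (pathWithEdges k)) : ℝ)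
          - (((k - 1) / 2 : ℕ) : ℝ) * ((n : ℝ) ^ 2 / 8))
        =o[atTop] fun n : ℕ => (n : ℝ) ^ 2) ∧
    (∀ k ∈ ({3, 5} : Set ℕ),
      (fun n : ℕ => (genTuran n triangleGraph (suspension (pathWithEdges k)) : ℝ)
          - (((k - 1) / 2 : ℕ) : ℝ) * ((n : ℝ) ^ 2 / 8))
        =O[atTop] fun n : ℕ => (n : ℝ)) ∧
    (∀ n : ℕ, 1 ≤ n → ∀ G : SimpleGraph (Fin n), (suspension (pathWithEdges 3)).Free G →
      (G.copyCount triangleGraph : ℝ) < (n : ℝ) ^ 2 / 8 + 3 * n) ∧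
    (∀ n : ℕ, 1 ≤ n → ∀ G : SimpleGraph (Fin n), (suspension (pathWithEdges 5)).Free G →
      (G.copyCount triangleGraph : ℝ) ≤ (n : ℝ) ^ 2 / 4 + 5 * n) := by
  refine ⟨?_, ?_, ?_, ?_⟩
  · rintro k (rfl | rfl | rfl)
    · exact (SuspendedPath.genTuran_sub_isBigO (.inl rfl)).trans_isLittleO
        SuspendedPath.natCast_isLittleO_sq
    · exact SuspendedPath.genTuran_four_sub_isLittleO
    · exact (SuspendedPath.genTuran_sub_isBigO (.inr rfl)).trans_isLittleO
        SuspendedPath.natCast_isLittleO_sq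
  · rintro k (rfl | rfl)
    · exact SuspendedPath.genTuran_sub_isBigO (.inl rfl)
    · exact SuspendedPath.genTuran_sub_isBigO (.inr rfl)
  · intro n hn G hG
    have h := SuspendedPath.copyCount_le_of_pathFree_four
      (SuspendedPath.locallyPathFree_of_free hG)
    -- Strictness comes from 5n/2 < 3n, which needs n to be positive.
    have : (1 : ℝ) ≤ n := by exact_mod_cast hn
    linarith
  · intro n _ G hG
    exact SuspendedPath.copyCount_le_of_pathFree_six (SuspendedPath.locallyPathFree_of_free hG)
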